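/- Let $n\ge 2$ and let $t_1,\dots,t_n\ge 3$ be integers. The generalized Brussels sprouts game $BS_n(\mathcal P_4:t_1,\dots,t_n)$ is played on the sphere (equivalently, in the plane). It starts with $n$ spots, the $i$-th spot having $t_i$ open tips. A move joins two distinct open tips by a curve that crosses neither itself nor anything drawn before, and then draws a crossbar on this curve; the crossbar provides two new open tips, one on each side of the curve, and the two joined tips are used up. The graph whose vertices are the spots and the points where a crossbar meets its curve, and whose edges are the pieces of the curves between consecutive such vertices, must at all times belong to the family $\mathcal P_4$ of planar graphs of girth at least $4$ (in particular it has no loops, no parallel edges and no triangles). The game ends when no move is possible. Then every play of $BS_n(\mathcal P_4:t_1,\dots,t_n)$ ends: no sequence of moves is longer than $(n-2)+\sum_{i=1}^n t_i$. Moreover, if a play ends after exactly $x$ moves, then $$n+4\;\le\; x\;\le\;(n-2)+\sum_{i=1}^n t_i .$$ -/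

import Mathlib

/-!
Generalized Brussels sprouts on the sphere (equivalently, in the plane).

A position is a plane drawing, recorded up to homeomorphism by its half-edges: the cyclic order of
the half-edges around each vertex, the pairing of half-edges into edges (an unpaired half-edge is an
open tip), and which sides of half-edges lie in the same region of the drawing.  The drawing may be
disconnected, so a region may have several boundary components.
-/

namespace BrusselsSprout

/-- The vertices after `k` moves: the `n` initial spots, and for each move the point where its
crossbar meets its curve. -/
abbrev Vertex (n k : ℕ) : Type := Fin n ⊕ Fin k

/-- The half-edges after `k` moves: `t i` of them at the spot `i`, and four at each crossbar vertex.
At a crossbar vertex, the half-edges `0` and `2` are the two halves of the curve and `1` and `3` are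
the two arms of the crossbar. -/
abbrev HalfEdge {n : ℕ} (t : Fin n → ℕ) (k : ℕ) : Type := (Σ i : Fin n, Fin (t i)) ⊕ (Fin k × Fin 4)

variable {n : ℕ} {t : Fin n → ℕ} {k : ℕ}

/-- The vertex from which a half-edge emanates. -/
def HalfEdge.vertex : HalfEdge t k → Vertex n k
  | .inl d => .inl d.1
  | .inr d => .inr d.1

/-- The next half-edge, in clockwise order, around the same vertex. -/
def HalfEdge.rot : HalfEdge t k → HalfEdge t k
  | .inl d => .inl ⟨d.1, finRotate (t d.1) d.2⟩
  | .inr d => .inr (d.1, d.2 + 1)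

/-- A half-edge of the current drawing, seen in the drawing after one more move. -/
def HalfEdge.old (d : HalfEdge t k) : HalfEdge t (k + 1) :=
  Sum.map id (Prod.map Fin.castSucc id) d

/-- The four half-edges, in clockwise order, at the vertex added by the last move. -/
def HalfEdge.new (s : Fin 4) : HalfEdge t (k + 1) :=
  .inr (Fin.last k, s)

/-- A drawing on the sphere with half-edges `HalfEdge t k`.

`mate d` is the other half of the edge containing `d`, and is `d` itself when `d` is an open tip.

`region d e` means that the same region (connected component of the complement of the drawing) lies
to the left of `d` and to the left of `e`, both directed away from their vertices.  Following `d`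
outwards with this region on the left one arrives along `mate d` (for an open tip: one turns round
the free end and comes back along `d`), and goes on along the next half-edge in clockwise order. -/
structure Drawing (t : Fin n → ℕ) (k : ℕ) where
  mate : HalfEdge t k → HalfEdge t k
  mate_mate : ∀ d, mate (mate d) = d
  region : Setoid (HalfEdge t k)
  region_rot_mate : ∀ d, region d (mate d).rot

namespace Drawing

/-- `d` is an open tip. -/
def IsTip (D : Drawing t k) (d : HalfEdge t k) : Prop := D.mate d = d

/-- One step along the boundary of the region to the left of `d`. -/
def next (D : Drawing t k) (d : HalfEdge t k) : HalfEdge t k := (D.mate d).rot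

/-- The left sides of `d` and `e` are on the same boundary component of the same region: the
boundary walk that starts with `d` passes through `e`. -/
def SameBoundary (D : Drawing t k) (d e : HalfEdge t k) : Prop := ∃ m : ℕ, D.next^[m] d = e

/-- The (multi)graph that is drawn: its edges are the pairs of mated half-edges; open tips do not
count. -/
def graph (D : Drawing t k) : Graph (Vertex n k) (Sym2 (HalfEdge t k)) where
  vertexSet := Set.univ
  IsLink e x y := ∃ d, ¬ D.IsTip d ∧ e = s(d, D.mate d) ∧ d.vertex = x ∧ (D.mate d).vertex = y
  isLink_symm := by
    intro e _
    refine ⟨?_⟩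
    rintro x y ⟨d, hd, rfl, rfl, rfl⟩
    refine ⟨D.mate d, ?_, ?_, rfl, ?_⟩
    · intro h
      exact hd ((D.mate_mate d).symm.trans h).symm
    · rw [D.mate_mate, Sym2.eq_swap]
    · rw [D.mate_mate]
  eq_or_eq_of_isLink_of_isLink := by
    rintro e x y v w ⟨d, -, rfl, rfl, rfl⟩ ⟨d', -, h, rfl, rfl⟩
    rcases Sym2.eq_iff.1 h with ⟨h₁, -⟩ | ⟨h₁, -⟩
    · exact Or.inl (by rw [h₁])
    · exact Or.inr (by rw [h₁])
  left_mem_of_isLink := fun _ _ _ _ => Set.mem_univ _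

/-- The initial position: all half-edges are open tips, and the complement of the `n` spots is a
single region. -/
def start (t : Fin n → ℕ) : Drawing t 0 where
  mate d := d
  mate_mate _ := rfl
  region := ⊤
  region_rot_mate _ := trivial

/-- `D'` arises from `D` by joining the open tips `a` and `b` by a curve inside a region of `D`, and
drawing a crossbar on it.

The first half of the curve is `a` and `new 0`, the second half is `b` and `new 2`, and `new 1` and
`new 3` are the open tips on its two sides.  All regions of `D` other than the one that contains the
curve persist.  If `a` and `b` are on the same boundary component of that region, then the curve
cuts it into two regions, one on either side of the curve, and each of the other boundary components
may be on either side; otherwise the curve does not separate the region. -/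
structure IsMove (D : Drawing t k) (a b : HalfEdge t k) (D' : Drawing t (k + 1)) : Prop where
  isTip_left : D.IsTip a
  isTip_right : D.IsTip b
  ne : a ≠ b
  region : D.region a b
  mate_left : D'.mate a.old = .new 0
  mate_right : D'.mate b.old = .new 2
  isTip_new_one : D'.IsTip (.new 1)
  isTip_new_three : D'.IsTip (.new 3)
  mate_old : ∀ d, d ≠ a → d ≠ b → D'.mate d.old = (D.mate d).old
  region_of_region : ∀ d e, D'.region d.old e.old → D.region d e
  region_persists : ∀ d e, ¬ D.region a d → D.region d e → D'.region d.old e.old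
  region_split : ∀ d, D.region a d → D'.region (.new 1) d.old ∨ D'.region (.new 3) d.old
  separates_iff : ¬ D'.region (.new 1) (.new 3) ↔ D.SameBoundary a b

end Drawing

/-- The positions that can be reached after `k` moves in the game, played on the sphere, for a family
`F` of graphs, from spots with `t i` open tips: after each move the graph drawn must belong to `F`. -/
inductive Reachable (F : ∀ {α β : Type}, Graph α β → Prop) (t : Fin n → ℕ) :
    ∀ k : ℕ, Drawing t k → Prop
  | start : Reachable F t 0 (Drawing.start t)
  | move {k : ℕ} {D : Drawing t k} {D' : Drawing t (k + 1)} {a b : HalfEdge t k} :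
      Reachable F t k D → D.IsMove a b D' → F D'.graph → Reachable F t (k + 1) D'

/-- The game is over: there is no valid move. -/
def Ended (F : ∀ {α β : Type}, Graph α β → Prop) (D : Drawing t k) : Prop :=
  ∀ (a b : HalfEdge t k) (D' : Drawing t (k + 1)), D.IsMove a b D' → ¬ F D'.graph

/-- Girth at least four: no loops, no parallel edges, no triangles.  A graph with a drawing on the
sphere is planar, so the graphs of drawings with this property are exactly the triangle-free planar
graphs that occur in the game. -/
def GirthAtLeastFour {α β : Type} (G : Graph α β) : Prop :=
  G.Simple ∧ 4 ≤ G.toSimpleGraph.egirth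

end BrusselsSprout

/-!
Each move increases `k` by one and either splits a boundary component and a region, or merges two
boundary components without creating a region. With `f` boundary components in `r` regions, this
gives `k + f + 2 ≤ n + 2 r`. Every boundary component always keeps an open tip, because the
crossbar leaves one on either side of the curve, and the number of open tips never changes. So
`r ≤ f ≤ ∑ i, t i`, which is the upper bound.

Let `c` be the number of connected components of the drawing. As regions and components are
joined in a connected incidence graph with `f` edges, `r + c ≤ f + 1`, and cutting the edges one
by one gives Euler's inequality `n + f ≤ k + 2 c`. With the estimate above, both must be
equalities, so an edge with the same boundary component on both sides is a bridge, and two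
boundary components of one region are never in the same component of the drawing. When the play
has ended, two open tips in a region are at equal or adjacent vertices, since otherwise they
could be joined; hence the drawing is connected, and the lower bound `n + 4 ≤ k` says that it has
at least six faces.

To find six faces, pass to a minimal piece that can be cut off along bridges. In such a piece a
face has at most one open tip that belongs to a crossbar. A boundary walk that leaves a spot
along an edge goes on to later and later crossbars until it meets such a tip, so distinct edges
at spots lead to distinct faces. It remains to find six edges at spots: every spot has at least
two, and if there are only two spots, both have at least three, since otherwise a triangle would
arise.
-/

namespace BrusselsSprout

variable {n : ℕ} {t : Fin n → ℕ} {k : ℕ}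

/-- A vertex of the current drawing, seen in the drawing after one more move. -/
def Vertex.old (x : Vertex n k) : Vertex n (k + 1) := Sum.map id Fin.castSucc x

/-- The vertex added by the last move. -/
def Vertex.new : Vertex n (k + 1) := .inr (Fin.last k)

theorem Vertex.old_injective : Function.Injective (old : Vertex n k → Vertex n (k + 1)) :=
  Function.Injective.sumMap Function.injective_id (Fin.castSucc_injective _)

theorem Vertex.old_ne_new (x : Vertex n k) : x.old ≠ Vertex.new := by
  rcases x with i | j <;> intro h
  · cases h
  · exact (Fin.castSucc_lt_last j).ne (Sum.inr.inj h)

theorem Vertex.eq_new_or_eq_old (x : Vertex n (k + 1)) :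
    x = Vertex.new ∨ ∃ y : Vertex n k, x = y.old := by
  rcases x with i | j
  · exact .inr ⟨.inl i, rfl⟩
  · induction j using Fin.lastCases with
    | last => exact .inl rfl
    | cast j => exact .inr ⟨.inr j, rfl⟩

theorem exists_finRotate_iterate_eq {N : ℕ} (p q : Fin N) : ∃ m, (finRotate N)^[m] p = q := by
  rcases N with _ | N
  · exact p.elim0
  open scoped Fin.CommRing in
  have iterate_eq : ∀ m : ℕ, (finRotate (N + 1))^[m] p = p + (m : Fin (N + 1)) := by
    intro m
    induction m with
    | zero => simp
    | succ m ih => rw [Function.iterate_succ_apply', ih, finRotate_apply]; push_cast; abel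
  exact ⟨(q - p).val, by rw [iterate_eq, Fin.cast_val_eq_self, add_sub_cancel]⟩

theorem exists_iterate_eq_symm {α : Type*} [Finite α] {f : α → α} (hf : Function.Injective f)
    {x y : α} {m : ℕ} (h : f^[m] x = y) : ∃ l, f^[l] y = x := by
  obtain ⟨p, hp, hpx⟩ := hf.mem_periodicPts x
  refine ⟨p * m - m, ?_⟩
  rw [← h, ← Function.iterate_add_apply, Nat.sub_add_cancel (Nat.le_mul_of_pos_left m hp)]
  exact mul_comm m p ▸ (Function.IsPeriodicPt.const_mul hpx m).eq

namespace HalfEdge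

theorem old_or_new (x : HalfEdge t (k + 1)) :
    (∃ d : HalfEdge t k, x = d.old) ∨ ∃ s, x = new s := by
  rcases x with d | ⟨j, s⟩
  · exact .inl ⟨.inl d, rfl⟩
  · induction j using Fin.lastCases with
    | last => exact .inr ⟨s, rfl⟩
    | cast i => exact .inl ⟨.inr (i, s), rfl⟩

@[elab_as_elim]
theorem cases_old_new {P : HalfEdge t (k + 1) → Prop} (x : HalfEdge t (k + 1))
    (old : ∀ d : HalfEdge t k, P d.old) (new : ∀ s, P (new s)) : P x := by
  rcases old_or_new x with ⟨d, rfl⟩ | ⟨s, rfl⟩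
  exacts [old d, new s]

/-- The function on the half-edges after one more move that is `f` on the old half-edges and `g` on
the new ones. -/
def elim {β : Type*} (f : HalfEdge t k → β) (g : Fin 4 → β) : HalfEdge t (k + 1) → β
  | .inl d => f (.inl d)
  | .inr (j, s) => Fin.lastCases (motive := fun _ => β) (g s) (fun i => f (.inr (i, s))) j

@[simp] theorem elim_old {β : Type*} (f : HalfEdge t k → β) (g : Fin 4 → β) (d : HalfEdge t k) :
    elim f g d.old = f d := by
  rcases d with d | ⟨j, s⟩ <;> simp [elim, old]

@[simp] theorem elim_new {β : Type*} (f : HalfEdge t k → β) (g : Fin 4 → β) (s : Fin 4) :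
    elim f g (new s) = g s := by
  simp [elim, new]

theorem old_injective : Function.Injective (old : HalfEdge t k → HalfEdge t (k + 1)) :=
  Function.Injective.sumMap Function.injective_id
    ((Fin.castSucc_injective _).prodMap Function.injective_id)

@[simp] theorem old_inj {x y : HalfEdge t k} : x.old = y.old ↔ x = y := old_injective.eq_iff

@[simp] theorem new_inj {s s' : Fin 4} :
    (new s : HalfEdge t (k + 1)) = new s' ↔ s = s' := by simp [new]

theorem rot_old (x : HalfEdge t k) : x.old.rot = x.rot.old := by
  rcases x with d | ⟨j, s⟩ <;> rfl

theorem rot_new (s : Fin 4) : (new s : HalfEdge t (k + 1)).rot = new (s + 1) := rfl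

@[simp] theorem vertex_rot (x : HalfEdge t k) : x.rot.vertex = x.vertex := by
  rcases x with d | ⟨j, s⟩ <;> rfl

@[simp] theorem vertex_old (x : HalfEdge t k) : x.old.vertex = x.vertex.old := by
  rcases x with d | ⟨j, s⟩ <;> rfl

@[simp] theorem vertex_new (s : Fin 4) : (new s : HalfEdge t (k + 1)).vertex = Vertex.new := rfl

theorem vertex_old_inj {x y : HalfEdge t k} :
    x.old.vertex = y.old.vertex ↔ x.vertex = y.vertex := by
  rw [vertex_old, vertex_old, Vertex.old_injective.eq_iff]

theorem vertex_old_ne_new (x : HalfEdge t k) (s : Fin 4) :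
    x.old.vertex ≠ (new s : HalfEdge t (k + 1)).vertex := by
  rw [vertex_old, vertex_new]
  exact x.vertex.old_ne_new

@[simp] theorem old_ne_new (x : HalfEdge t k) (s : Fin 4) : x.old ≠ new s := fun h =>
  vertex_old_ne_new x s (congrArg vertex h)

@[simp] theorem new_ne_old (x : HalfEdge t k) (s : Fin 4) : new s ≠ x.old := (old_ne_new x s).symm

theorem rot_injective : Function.Injective (rot : HalfEdge t k → HalfEdge t k) := by
  rintro (⟨i, x⟩ | ⟨j, s⟩) (⟨i', x'⟩ | ⟨j', s'⟩) h
  · simp only [rot, Sum.inl.injEq, Sigma.mk.injEq] at h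
    obtain ⟨rfl, h⟩ := h
    simpa using h
  · simp [rot] at h
  · simp [rot] at h
  · simpa [rot] using h

theorem rot_iterate_spot (i : Fin n) (p : Fin (t i)) (m : ℕ) :
    (rot : HalfEdge t k → _)^[m] (.inl ⟨i, p⟩) = .inl ⟨i, (finRotate (t i))^[m] p⟩ := by
  induction m with
  | zero => rfl
  | succ m ih => rw [Function.iterate_succ_apply', ih, Function.iterate_succ_apply']; rfl

theorem rot_iterate_crossbar (j : Fin k) (s : Fin 4) (m : ℕ) :
    (rot : HalfEdge t k → _)^[m] (.inr (j, s)) = .inr (j, (finRotate 4)^[m] s) := by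
  induction m with
  | zero => rfl
  | succ m ih =>
    rw [Function.iterate_succ_apply', ih, Function.iterate_succ_apply', finRotate_apply]; rfl

theorem exists_rot_iterate {x y : HalfEdge t k} (h : x.vertex = y.vertex) :
    ∃ m, rot^[m] x = y := by
  rcases x with ⟨i, p⟩ | ⟨j, s⟩ <;> rcases y with ⟨i', q⟩ | ⟨j', s'⟩
  · obtain rfl : i = i' := by simpa [vertex] using h
    obtain ⟨m, rfl⟩ := exists_finRotate_iterate_eq p q
    exact ⟨m, rot_iterate_spot i p m⟩
  · simp [vertex] at h
  · simp [vertex] at h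
  · obtain rfl : j = j' := by simpa [vertex] using h
    obtain ⟨m, rfl⟩ := exists_finRotate_iterate_eq s s'
    exact ⟨m, rot_iterate_crossbar j s m⟩

end HalfEdge

open HalfEdge

/-! ### Boundary components and connected components -/

namespace Drawing

variable {D : Drawing t k} {a d e : HalfEdge t k}

theorem isTip_mate : D.IsTip (D.mate d) ↔ D.IsTip d := by
  simp only [IsTip, D.mate_mate, eq_comm]

theorem IsTip.mate_ne (ha : D.IsTip a) (h : d ≠ a) : D.mate d ≠ a := by
  intro h'
  exact h (by rw [← D.mate_mate d, h', ha])

theorem IsTip.next_eq (h : D.IsTip d) : D.next d = d.rot := congrArg rot h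

theorem next_injective (D : Drawing t k) : Function.Injective D.next := by
  intro x y h
  have := congrArg D.mate (rot_injective h)
  simpa only [D.mate_mate] using this

theorem SameBoundary.refl (D : Drawing t k) (d : HalfEdge t k) : D.SameBoundary d d := ⟨0, rfl⟩

theorem SameBoundary.symm (h : D.SameBoundary d e) : D.SameBoundary e d := by
  obtain ⟨m, hm⟩ := h
  exact exists_iterate_eq_symm D.next_injective hm

theorem SameBoundary.trans {f : HalfEdge t k} (h : D.SameBoundary d e)
    (h' : D.SameBoundary e f) : D.SameBoundary d f := by
  obtain ⟨m, rfl⟩ := h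
  obtain ⟨l, rfl⟩ := h'
  exact ⟨l + m, Function.iterate_add_apply ..⟩

theorem SameBoundary.next (D : Drawing t k) (d : HalfEdge t k) : D.SameBoundary d (D.next d) :=
  ⟨1, rfl⟩

/-- The equivalence relation whose classes are the boundary components of the regions. -/
def boundary (D : Drawing t k) : Setoid (HalfEdge t k) where
  r := D.SameBoundary
  iseqv := ⟨.refl D, .symm, .trans⟩

theorem boundary_le {s : Setoid (HalfEdge t k)} (h : ∀ d, s d (D.next d)) : D.boundary ≤ s := by
  rintro d _ ⟨m, rfl⟩
  induction m with
  | zero => exact s.refl _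
  | succ m ih => rw [Function.iterate_succ_apply']; exact s.trans ih (h _)

theorem boundary_le_region : D.boundary ≤ D.region := boundary_le D.region_rot_mate

theorem SameBoundary.region (h : D.SameBoundary d e) : D.region d e := boundary_le_region h

/-- The equivalence relation whose classes are the connected components of the drawing, each one
given by its half-edges. -/
def component (D : Drawing t k) : Setoid (HalfEdge t k) :=
  Relation.EqvGen.setoid fun d e => e = d.rot ∨ e = D.mate d

theorem component_rot (D : Drawing t k) (d : HalfEdge t k) : D.component d d.rot :=
  .rel _ _ (.inl rfl)

theorem component_mate (D : Drawing t k) (d : HalfEdge t k) : D.component d (D.mate d) :=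
  .rel _ _ (.inr rfl)

theorem component_le {s : Setoid (HalfEdge t k)} (hrot : ∀ d, s d d.rot)
    (hmate : ∀ d, s d (D.mate d)) : D.component ≤ s :=
  Setoid.eqvGen_le fun d e h => by
    rcases h with rfl | rfl
    exacts [hrot d, hmate d]

theorem boundary_le_component : D.boundary ≤ D.component :=
  boundary_le fun d => D.component.trans (D.component_mate d) (D.component_rot _)

theorem SameBoundary.component (h : D.SameBoundary d e) : D.component d e :=
  boundary_le_component h

theorem component_of_vertex_eq (h : d.vertex = e.vertex) : D.component d e := by
  obtain ⟨m, rfl⟩ := exists_rot_iterate h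
  clear h
  induction m with
  | zero => exact D.component.refl _
  | succ m ih => rw [Function.iterate_succ_apply']; exact D.component.trans ih (D.component_rot _)

/-- The vertices `x` and `y` are joined by an edge. -/
def Adj (D : Drawing t k) (x y : Vertex n k) : Prop :=
  ∃ d, ¬ D.IsTip d ∧ d.vertex = x ∧ (D.mate d).vertex = y

theorem Adj.symm {x y : Vertex n k} (h : D.Adj x y) : D.Adj y x := by
  obtain ⟨d, hd, rfl, rfl⟩ := h
  exact ⟨D.mate d, by rwa [isTip_mate], rfl, by rw [D.mate_mate]⟩

theorem component_of_adj (h : D.Adj d.vertex e.vertex) : D.component d e := by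
  obtain ⟨c, -, hd, he⟩ := h
  exact D.component.trans (component_of_vertex_eq hd.symm)
    (D.component.trans (D.component_mate c) (component_of_vertex_eq he))

theorem graph_adj {x y : Vertex n k} : D.graph.Adj x y ↔ D.Adj x y := by
  constructor
  · rintro ⟨e, d, hd, -, h⟩
    exact ⟨d, hd, h⟩
  · rintro ⟨d, hd, h⟩
    exact ⟨_, d, hd, rfl, h⟩

/-- The drawn graph has no loops, no parallel edges and no triangles, expressed by half-edges. -/
structure Sparse (D : Drawing t k) : Prop where
  not_adj_self : ∀ x, ¬ D.Adj x x
  eq_of_vertex : ∀ d e, ¬ D.IsTip d → ¬ D.IsTip e → d.vertex = e.vertex →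
    (D.mate d).vertex = (D.mate e).vertex → d = e
  no_triangle : ∀ x y z, D.Adj x y → D.Adj y z → ¬ D.Adj z x

theorem sparse_of_girthAtLeastFour (h : GirthAtLeastFour D.graph) : D.Sparse := by
  classical
  obtain ⟨hsimple, hgirth⟩ := h
  refine ⟨fun x hx => D.graph.not_adj_self x (graph_adj.2 hx), fun d e hd he hv hm => ?_,
    fun x y z hxy hyz hzx => ?_⟩
  · have := hsimple.eq_of_isLink (e := s(d, D.mate d)) (f := s(e, D.mate e)) ⟨d, hd, rfl, rfl, rfl⟩
      ⟨e, he, rfl, hv.symm, hm.symm⟩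
    rcases Sym2.eq_iff.1 this with ⟨hde, -⟩ | ⟨-, hde⟩
    · exact hde
    · refine absurd (graph_adj.2 ⟨d, hd, rfl, ?_⟩) (D.graph.not_adj_self d.vertex)
      rw [hde, ← hv]
  · have toSimpleGraph_adj : ∀ {x y : Vertex n k}, D.Adj x y →
        D.graph.toSimpleGraph.Adj ⟨x, Set.mem_univ x⟩ ⟨y, Set.mem_univ y⟩ := fun h =>
      (Graph.toSimpleGraph_adj_iff ..).2 (graph_adj.2 h)
    obtain ⟨u, w, hw, hlength⟩ := SimpleGraph.is3Clique_iff_exists_cycle_length_three.1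
      ⟨_, SimpleGraph.is3Clique_triple_iff.2
        ⟨toSimpleGraph_adj hxy, toSimpleGraph_adj hzx.symm, toSimpleGraph_adj hyz⟩⟩
    have := SimpleGraph.le_egirth.1 hgirth u w hw
    rw [hlength] at this
    exact absurd this (by decide)

theorem Sparse.girthAtLeastFour (h : D.Sparse) : GirthAtLeastFour D.graph := by
  have loopless : D.graph.Loopless := ⟨fun e x hx => h.not_adj_self x (graph_adj.1 ⟨e, hx⟩)⟩
  refine ⟨{ toLoopless := loopless, eq_of_isLink := ?_ }, SimpleGraph.le_egirth.2 fun u w hw => ?_⟩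
  · rintro _ _ x y ⟨d, hd, rfl, rfl, rfl⟩ ⟨e, he, rfl, hv, hm⟩
    rw [h.eq_of_vertex d e hd he hv.symm hm.symm]
  · rcases hw.three_le_length.eq_or_lt with hthree | hfour
    · have hadj : ∀ {x y}, D.graph.toSimpleGraph.Adj x y → D.Adj x y := fun h => graph_adj.1 h.2
      match w, hthree with
      | .cons h₁ (.cons h₂ (.cons h₃ .nil)), _ =>
        exact absurd (hadj h₃) (h.no_triangle _ _ _ (hadj h₁) (hadj h₂))
    · exact_mod_cast hfour

theorem sparse_iff : GirthAtLeastFour D.graph ↔ D.Sparse :=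
  ⟨sparse_of_girthAtLeastFour, Sparse.girthAtLeastFour⟩

end Drawing

/-! ### Half-edges and edges after a move -/

namespace Drawing

variable {D : Drawing t k} {a b : HalfEdge t k} {D' : Drawing t (k + 1)}

/-- The map that sends the old half-edges to themselves and the new ones to `a`; it carries the
equivalence relations of the drawing after a move that joins `a` to those of the drawing before. -/
def proj (a : HalfEdge t k) : HalfEdge t (k + 1) → HalfEdge t k := elim id fun _ => a

@[simp] theorem proj_old (a d : HalfEdge t k) : proj a d.old = d := elim_old ..

@[simp] theorem proj_new (a : HalfEdge t k) (s : Fin 4) : proj a (new s) = a := elim_new ..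

namespace IsMove

theorem mate_new_zero (h : D.IsMove a b D') : D'.mate (new 0) = a.old := by
  rw [← h.mate_left, D'.mate_mate]

theorem mate_new_two (h : D.IsMove a b D') : D'.mate (new 2) = b.old := by
  rw [← h.mate_right, D'.mate_mate]

theorem mate_old_cases (h : D.IsMove a b D') (d : HalfEdge t k) :
    (d = a ∧ D'.mate d.old = new 0) ∨ (d = b ∧ D'.mate d.old = new 2) ∨
      (d ≠ a ∧ d ≠ b ∧ D'.mate d.old = (D.mate d).old) := by
  by_cases ha : d = a
  · exact .inl ⟨ha, ha ▸ h.mate_left⟩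
  by_cases hb : d = b
  · exact .inr (.inl ⟨hb, hb ▸ h.mate_right⟩)
  exact .inr (.inr ⟨ha, hb, h.mate_old d ha hb⟩)

theorem next_old (h : D.IsMove a b D') {d : HalfEdge t k} (ha : d ≠ a) (hb : d ≠ b) :
    D'.next d.old = (D.next d).old := by
  rw [Drawing.next, h.mate_old d ha hb, rot_old, Drawing.next]

theorem next_left (h : D.IsMove a b D') : D'.next a.old = new 1 := by
  rw [Drawing.next, h.mate_left]; rfl

theorem next_right (h : D.IsMove a b D') : D'.next b.old = new 3 := by
  rw [Drawing.next, h.mate_right]; rfl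

theorem next_new_zero (h : D.IsMove a b D') : D'.next (new 0) = (D.next a).old := by
  rw [Drawing.next, h.mate_new_zero, rot_old, Drawing.next, h.isTip_left]

theorem next_new_one (h : D.IsMove a b D') : D'.next (new 1) = new 2 := by
  rw [Drawing.next, h.isTip_new_one]; rfl

theorem next_new_three (h : D.IsMove a b D') : D'.next (new 3) = new 0 := by
  rw [Drawing.next, h.isTip_new_three]; rfl

theorem isTip_old (h : D.IsMove a b D') {d : HalfEdge t k} :
    D'.IsTip d.old ↔ D.IsTip d ∧ d ≠ a ∧ d ≠ b := by
  rcases h.mate_old_cases d with ⟨rfl, hm⟩ | ⟨rfl, hm⟩ | ⟨ha, hb, hm⟩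
  · simp [IsTip, hm]
  · simp [IsTip, hm]
  · simp [IsTip, hm, ha, hb]

theorem isTip_new (h : D.IsMove a b D') {s : Fin 4} : D'.IsTip (new s) ↔ s = 1 ∨ s = 3 := by
  fin_cases s
  · simp [IsTip, h.mate_new_zero]
  · simpa using h.isTip_new_one
  · simp [IsTip, h.mate_new_two]
  · simpa using h.isTip_new_three

theorem sameBoundary_left (h : D.IsMove a b D') : D'.SameBoundary a.old (new 1) := ⟨1, h.next_left⟩

theorem sameBoundary_right (h : D.IsMove a b D') : D'.SameBoundary b.old (new 3) :=
  ⟨1, h.next_right⟩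

theorem sameBoundary_one_two (h : D.IsMove a b D') : D'.SameBoundary (new 1) (new 2) :=
  ⟨1, h.next_new_one⟩

theorem sameBoundary_three_zero (h : D.IsMove a b D') : D'.SameBoundary (new 3) (new 0) :=
  ⟨1, h.next_new_three⟩

theorem sameBoundary_new_new (h : D.IsMove a b D') (s : Fin 4) :
    D'.SameBoundary (new s) (new 1) ∨ D'.SameBoundary (new s) (new 3) := by
  fin_cases s
  · exact .inr h.sameBoundary_three_zero.symm
  · exact .inl (.refl ..)
  · exact .inl h.sameBoundary_one_two.symm
  · exact .inr (.refl ..)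

theorem sameBoundary_old (h : D.IsMove a b D') {d e : HalfEdge t k} (ha : ¬ D.SameBoundary d a)
    (hb : ¬ D.SameBoundary d b) (hde : D.SameBoundary d e) : D'.SameBoundary d.old e.old := by
  obtain ⟨m, rfl⟩ := hde
  induction m with
  | zero => exact .refl ..
  | succ m ih =>
    refine ih.trans ⟨1, ?_⟩
    rw [Function.iterate_succ_apply' D.next, Function.iterate_one, h.next_old]
    exacts [fun h => ha ⟨m, h⟩, fun h => hb ⟨m, h⟩]

theorem sameBoundary_new (h : D.IsMove a b D') {d : HalfEdge t k}
    (hd : D.SameBoundary d a ∨ D.SameBoundary d b) :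
    D'.SameBoundary d.old (new 1) ∨ D'.SameBoundary d.old (new 3) := by
  obtain ⟨m, hm⟩ : ∃ m, D.next^[m] d = a ∨ D.next^[m] d = b := by
    rcases hd with ⟨m, hm⟩ | ⟨m, hm⟩
    exacts [⟨m, .inl hm⟩, ⟨m, .inr hm⟩]
  clear hd
  induction m generalizing d with
  | zero =>
    rcases hm with rfl | rfl
    exacts [.inl h.sameBoundary_left, .inr h.sameBoundary_right]
  | succ m ih =>
    by_cases ha : d = a
    · exact .inl (ha ▸ h.sameBoundary_left)
    by_cases hb : d = b
    · exact .inr (hb ▸ h.sameBoundary_right)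
    have next := SameBoundary.next D' d.old
    rw [h.next_old ha hb] at next
    exact (ih hm).imp next.trans next.trans

theorem exists_old_region (h : D.IsMove a b D') (x : HalfEdge t (k + 1)) :
    ∃ d, D'.region x d.old ∧ D.region d (proj a x) := by
  induction x using cases_old_new with
  | old d => exact ⟨d, D'.region.refl _, by rw [proj_old]⟩
  | new s =>
    rw [proj_new]
    rcases h.sameBoundary_new_new s with hs | hs
    · exact ⟨a, (hs.trans h.sameBoundary_left.symm).region, D.region.refl _⟩
    · exact ⟨b, (hs.trans h.sameBoundary_right.symm).region, D.region.symm h.region⟩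

theorem region_proj (h : D.IsMove a b D') {x y : HalfEdge t (k + 1)} (hxy : D'.region x y) :
    D.region (proj a x) (proj a y) := by
  obtain ⟨d, hd, hd'⟩ := h.exists_old_region x
  obtain ⟨e, he, he'⟩ := h.exists_old_region y
  have := h.region_of_region d e (D'.region.trans (D'.region.symm hd) (D'.region.trans hxy he))
  exact D.region.trans (D.region.symm hd') (D.region.trans this he')

theorem adj_old (h : D.IsMove a b D') {x y : Vertex n k} : D'.Adj x.old y.old ↔ D.Adj x y := by
  constructor
  · rintro ⟨d, hd, hx, hy⟩
    induction d using cases_old_new with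
    | new s => exact absurd hx.symm x.old_ne_new
    | old d =>
      rcases h.mate_old_cases d with ⟨-, hm⟩ | ⟨-, hm⟩ | ⟨ha, hb, hm⟩ <;> rw [hm] at hy
      · exact absurd hy.symm y.old_ne_new
      · exact absurd hy.symm y.old_ne_new
      · rw [vertex_old] at hx hy
        exact ⟨d, fun htip => hd (h.isTip_old.2 ⟨htip, ha, hb⟩), Vertex.old_injective hx,
          Vertex.old_injective hy⟩
  · rintro ⟨d, hd, rfl, rfl⟩
    refine ⟨d.old, fun htip => hd (h.isTip_old.1 htip).1, vertex_old _, ?_⟩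
    rw [h.mate_old, vertex_old]
    exacts [fun hda => hd (hda ▸ h.isTip_left), fun hdb => hd (hdb ▸ h.isTip_right)]

theorem adj_new (h : D.IsMove a b D') {x : Vertex n (k + 1)} (hx : D'.Adj Vertex.new x) :
    x = a.vertex.old ∨ x = b.vertex.old := by
  obtain ⟨d, hd, hl, rfl⟩ := hx
  induction d using cases_old_new with
  | old d => exact absurd hl (vertex_old_ne_new d 0)
  | new s =>
    rw [h.isTip_new] at hd
    fin_cases s
    · exact .inl (by rw [← vertex_old, ← h.mate_new_zero]; rfl)
    · simp at hd
    · exact .inr (by rw [← vertex_old, ← h.mate_new_two]; rfl)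
    · simp at hd

theorem not_adj_self (h : D.IsMove a b D') (hD : D.Sparse) (x : Vertex n (k + 1)) :
    ¬ D'.Adj x x := by
  intro hx
  rcases x.eq_new_or_eq_old with rfl | ⟨y, rfl⟩
  · rcases h.adj_new hx with h' | h'
    exacts [Vertex.old_ne_new _ h'.symm, Vertex.old_ne_new _ h'.symm]
  · exact hD.not_adj_self y (h.adj_old.1 hx)

theorem no_triangle_new (h : D.IsMove a b D') (hD : D.Sparse)
    (hadj : ¬ D.Adj a.vertex b.vertex) {y z : Vertex n (k + 1)} (hy : D'.Adj Vertex.new y)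
    (hyz : D'.Adj y z) : ¬ D'.Adj z Vertex.new := by
  intro hz
  rw [← h.adj_old] at hadj
  rcases h.adj_new hy with rfl | rfl <;> rcases h.adj_new hz.symm with rfl | rfl
  exacts [h.not_adj_self hD _ hyz, hadj hyz, hadj hyz.symm, h.not_adj_self hD _ hyz]

theorem eq_of_vertex_new (h : D.IsMove a b D') (hne : a.vertex ≠ b.vertex) {s s' : Fin 4}
    (hs : ¬ D'.IsTip (new s)) (hs' : ¬ D'.IsTip (new s'))
    (hv : (D'.mate (new s)).vertex = (D'.mate (new s')).vertex) : s = s' := by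
  have hcases : ∀ s : Fin 4, ¬ (s = 1 ∨ s = 3) → s = 0 ∨ s = 2 := by decide
  rw [h.isTip_new] at hs hs'
  rcases hcases s hs with rfl | rfl <;> rcases hcases s' hs' with rfl | rfl <;>
    simp only [h.mate_new_zero, h.mate_new_two, vertex_old_inj] at hv
  exacts [rfl, absurd hv hne, absurd hv.symm hne, rfl]

theorem eq_of_vertex_old (h : D.IsMove a b D') (hD : D.Sparse) (hne : a.vertex ≠ b.vertex)
    {d e : HalfEdge t k} (hd : ¬ D'.IsTip d.old) (he : ¬ D'.IsTip e.old)
    (hv : d.vertex = e.vertex) (hm : (D'.mate d.old).vertex = (D'.mate e.old).vertex) : d = e := by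
  rw [h.isTip_old] at hd he
  rcases h.mate_old_cases d with ⟨rfl, hmd⟩ | ⟨rfl, hmd⟩ | ⟨hda, hdb, hmd⟩ <;>
    rcases h.mate_old_cases e with ⟨rfl, hme⟩ | ⟨rfl, hme⟩ | ⟨hea, heb, hme⟩ <;>
    simp only [hmd, hme] at hm
  · rfl
  · exact absurd hv hne
  · exact absurd hm.symm (vertex_old_ne_new _ _)
  · exact absurd hv.symm hne
  · rfl
  · exact absurd hm.symm (vertex_old_ne_new _ _)
  · exact absurd hm (vertex_old_ne_new _ _)
  · exact absurd hm (vertex_old_ne_new _ _)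
  · exact hD.eq_of_vertex d e (fun h => hd ⟨h, hda, hdb⟩) (fun h => he ⟨h, hea, heb⟩) hv
      (vertex_old_inj.1 hm)

theorem sparse (h : D.IsMove a b D') (hD : D.Sparse) (hne : a.vertex ≠ b.vertex)
    (hadj : ¬ D.Adj a.vertex b.vertex) : D'.Sparse := by
  refine ⟨h.not_adj_self hD, fun d e hd he hv hm => ?_, fun x y z hxy hyz hzx => ?_⟩
  · induction d using cases_old_new with
    | new s =>
      induction e using cases_old_new with
      | new s' => rw [h.eq_of_vertex_new hne hd he hm]
      | old e => exact absurd hv.symm (vertex_old_ne_new e s)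
    | old d =>
      induction e using cases_old_new with
      | new s' => exact absurd hv (vertex_old_ne_new d s')
      | old e => rw [h.eq_of_vertex_old hD hne hd he (vertex_old_inj.1 hv) hm]
  · rcases x.eq_new_or_eq_old with rfl | ⟨x, rfl⟩
    · exact h.no_triangle_new hD hadj hxy hyz hzx
    rcases y.eq_new_or_eq_old with rfl | ⟨y, rfl⟩
    · exact h.no_triangle_new hD hadj hyz hzx hxy
    rcases z.eq_new_or_eq_old with rfl | ⟨z, rfl⟩
    · exact h.no_triangle_new hD hadj hzx hxy hyz
    exact hD.no_triangle _ _ _ (h.adj_old.1 hxy) (h.adj_old.1 hyz) (h.adj_old.1 hzx)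

end IsMove

/-! ### Existence of moves -/

/-- The boundary walk from `d` meets `a` without having met `b`. It decides on which side of a curve
from `a` to `b` the old half-edges lie. -/
def ReachesFirst (D : Drawing t k) (a b d : HalfEdge t k) : Prop :=
  ∃ m, D.next^[m] d = a ∧ ∀ j ≤ m, D.next^[j] d ≠ b

theorem reachesFirst_self (hne : a ≠ b) : D.ReachesFirst a b a :=
  ⟨0, rfl, fun _ hj => Nat.le_zero.1 hj ▸ hne⟩

theorem not_reachesFirst_self : ¬ D.ReachesFirst a b b := fun ⟨_, _, hj⟩ => hj 0 (Nat.zero_le _) rfl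

theorem reachesFirst_next {d : HalfEdge t k} (ha : d ≠ a) (hb : d ≠ b) :
    D.ReachesFirst a b (D.next d) ↔ D.ReachesFirst a b d := by
  constructor
  · rintro ⟨m, hm, hj⟩
    refine ⟨m + 1, hm, fun j hjm => ?_⟩
    rcases j with _ | j
    · exact hb
    · exact hj j (by omega)
  · rintro ⟨m, hm, hj⟩
    rcases m with _ | m
    · exact absurd hm ha
    · exact ⟨m, hm, fun j hjm => hj (j + 1) (by omega)⟩

theorem not_reachesFirst_next_left (h : D.SameBoundary a b) :
    ¬ D.ReachesFirst a b (D.next a) := by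
  rintro ⟨m, hm, hj⟩
  have periodic : ∀ l, ∃ j ≤ m, D.next^[l] (D.next a) = D.next^[j] (D.next a) := by
    intro l
    induction l with
    | zero => exact ⟨0, by omega, rfl⟩
    | succ l ih =>
      obtain ⟨j, hjm, ih⟩ := ih
      rw [Function.iterate_succ_apply', ih]
      rcases hjm.eq_or_lt with rfl | hlt
      · exact ⟨0, by omega, by rw [hm]; rfl⟩
      · exact ⟨j + 1, hlt, by rw [Function.iterate_succ_apply']⟩
  obtain ⟨l, hl⟩ := (SameBoundary.next D a).symm.trans h
  obtain ⟨j, hjm, h'⟩ := periodic l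
  exact hj j hjm (h'.symm.trans hl)

theorem reachesFirst_next_right (hne : a ≠ b) (h : D.SameBoundary a b) :
    D.ReachesFirst a b (D.next b) := by
  classical
  have hex : ∃ m, D.next^[m] (D.next b) = a := (SameBoundary.next D b).symm.trans h.symm
  refine ⟨Nat.find hex, Nat.find_spec hex, fun j hj hjb => ?_⟩
  rcases hj.eq_or_lt with rfl | hlt
  · exact hne ((Nat.find_spec hex).symm.trans hjb)
  · refine Nat.find_min hex (m := Nat.find hex - (j + 1)) (by omega) ?_
    have := Nat.find_spec hex
    rw [show Nat.find hex = (Nat.find hex - (j + 1)) + (j + 1) by omega,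
      Function.iterate_add_apply, Function.iterate_succ_apply', hjb] at this
    exact this

/-- The pairing of half-edges after a move that joins `a` and `b`. -/
def joinMate (D : Drawing t k) (a b : HalfEdge t k) : HalfEdge t (k + 1) → HalfEdge t (k + 1) :=
  elim (fun d => if d = a then new 0 else if d = b then new 2 else (D.mate d).old)
    ![a.old, new 1, b.old, new 3]

/-- The side of the curve joining `a` and `b` on which `new 1` lies. -/
def joinSide (D : Drawing t k) (a b : HalfEdge t k) : HalfEdge t (k + 1) → Prop :=
  elim (D.ReachesFirst a b) fun s => s = 1 ∨ s = 2

/-- The regions after a move that joins `a` and `b`: the region of `a` is cut along the curve when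
`a` and `b` are on the same boundary component. The remaining boundary components of that region are
all put on the side of `new 3`. -/
def joinRegion (D : Drawing t k) (a b : HalfEdge t k) : Setoid (HalfEdge t (k + 1)) where
  r x y := D.region (proj a x) (proj a y) ∧
    (D.SameBoundary a b → D.region a (proj a x) → (D.joinSide a b x ↔ D.joinSide a b y))
  iseqv :=
    { refl := fun _ => ⟨D.region.refl _, fun _ _ => Iff.rfl⟩
      symm := fun h => ⟨D.region.symm h.1,
        fun hab ha => (h.2 hab (D.region.trans ha (D.region.symm h.1))).symm⟩
      trans := fun h h' => ⟨D.region.trans h.1 h'.1,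
        fun hab ha => (h.2 hab ha).trans (h'.2 hab (D.region.trans ha h.1))⟩ }

section Join

variable (D a b)

@[simp] theorem joinMate_left : D.joinMate a b a.old = new 0 := by simp [joinMate]

@[simp] theorem joinMate_zero : D.joinMate a b (new 0) = a.old := by simp [joinMate]

@[simp] theorem joinMate_one : D.joinMate a b (new 1) = new 1 := by simp [joinMate]

@[simp] theorem joinMate_two : D.joinMate a b (new 2) = b.old := by simp [joinMate]

@[simp] theorem joinMate_three : D.joinMate a b (new 3) = new 3 := by simp [joinMate]

variable {a b}

theorem joinMate_right (hne : a ≠ b) : D.joinMate a b b.old = new 2 := by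
  simp [joinMate, hne.symm]

theorem joinMate_old {d : HalfEdge t k} (ha : d ≠ a) (hb : d ≠ b) :
    D.joinMate a b d.old = (D.mate d).old := by
  simp [joinMate, ha, hb]

variable {D}

theorem joinMate_joinMate (ha : D.IsTip a) (hb : D.IsTip b) (hne : a ≠ b)
    (x : HalfEdge t (k + 1)) : D.joinMate a b (D.joinMate a b x) = x := by
  induction x using cases_old_new with
  | old d =>
    by_cases hda : d = a
    · simp [hda]
    by_cases hdb : d = b
    · simp [hdb, joinMate_right D hne]
    rw [joinMate_old D hda hdb, joinMate_old D (ha.mate_ne hda) (hb.mate_ne hdb), D.mate_mate]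
  | new s => fin_cases s <;> simp [joinMate_right D hne]

theorem region_proj_rot_joinMate (ha : D.IsTip a) (hb : D.IsTip b) (hne : a ≠ b)
    (hr : D.region a b) (x : HalfEdge t (k + 1)) :
    D.region (proj a x) (proj a (D.joinMate a b x).rot) := by
  have next : ∀ d, D.region d (D.next d) := D.region_rot_mate
  have next_left : D.region a a.rot := ha.next_eq ▸ next a
  have next_right : D.region b b.rot := hb.next_eq ▸ next b
  induction x using cases_old_new with
  | old d =>
    by_cases hda : d = a
    · simp [hda, rot_new]
    by_cases hdb : d = b
    · simpa [hdb, joinMate_right D hne, rot_new] using D.region.symm hr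
    simpa [joinMate_old D hda hdb, rot_old, Drawing.next] using next d
  | new s =>
    fin_cases s
    · simpa [rot_old] using next_left
    · simp [rot_new]
    · simpa [rot_old] using D.region.trans hr next_right
    · simp [rot_new]

theorem joinSide_rot_joinMate (ha : D.IsTip a) (hb : D.IsTip b) (hne : a ≠ b)
    (hab : D.SameBoundary a b) (x : HalfEdge t (k + 1)) :
    D.joinSide a b (D.joinMate a b x).rot ↔ D.joinSide a b x := by
  have left : ¬ D.ReachesFirst a b a.rot :=
    ha.next_eq ▸ not_reachesFirst_next_left hab
  have right : D.ReachesFirst a b b.rot :=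
    hb.next_eq ▸ reachesFirst_next_right hne hab
  induction x using cases_old_new with
  | old d =>
    by_cases hda : d = a
    · simp [hda, rot_new, joinSide, reachesFirst_self hne]
    by_cases hdb : d = b
    · simp [hdb, joinMate_right D hne, rot_new, joinSide, not_reachesFirst_self]
    simpa [joinMate_old D hda hdb, rot_old, joinSide, Drawing.next] using reachesFirst_next hda hdb
  | new s => fin_cases s <;> simp [rot_old, rot_new, joinSide, left, right]

theorem exists_isMove (ha : D.IsTip a) (hb : D.IsTip b) (hne : a ≠ b) (hr : D.region a b) :
    ∃ D' : Drawing t (k + 1), D.IsMove a b D' := by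
  let D' : Drawing t (k + 1) :=
    { mate := D.joinMate a b
      mate_mate := joinMate_joinMate ha hb hne
      region := D.joinRegion a b
      region_rot_mate := fun x => ⟨region_proj_rot_joinMate ha hb hne hr x,
        fun hab _ => (joinSide_rot_joinMate ha hb hne hab x).symm⟩ }
  refine ⟨D', ha, hb, hne, hr, joinMate_left .., joinMate_right D hne, joinMate_one ..,
    joinMate_three .., fun d => joinMate_old D, fun d e h => by simpa using h.1, ?_, ?_, ?_⟩
  · intro d e had hde
    exact ⟨by simpa using hde, fun _ h => absurd (by simpa using h) had⟩
  · intro d had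
    by_cases hside : D.joinSide a b d.old
    · exact .inl ⟨by simpa using had, fun _ _ => iff_of_true (by simp [joinSide]) hside⟩
    · exact .inr ⟨by simpa using had, fun _ _ => iff_of_false (by simp [joinSide]) hside⟩
  · constructor
    · intro h
      by_contra hab
      exact h ⟨by simp, fun h => absurd h hab⟩
    · intro hab h
      simpa [joinSide] using h.2 hab (by simp)

end Join

end Drawing

/-! ### Classes of equivalence relations -/

section Setoid

variable {α β : Type*}

theorem quotientMap_surjective {r : Setoid α} {s : Setoid β} {f : α → β} (h : r ≤ s.comap f)
    (hf : ∀ y, ∃ x, s (f x) y) : Function.Surjective (Quotient.map f fun _ _ hxy => h hxy) :=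
  Quotient.ind fun y => (hf y).imp' (Quotient.mk r) fun _ hx => Quotient.sound hx

theorem card_quotient_le_of_map [Finite α] {r : Setoid α} {s : Setoid β} {f : α → β}
    (h : r ≤ s.comap f) (hf : ∀ y, ∃ x, s (f x) y) :
    Nat.card (Quotient s) ≤ Nat.card (Quotient r) :=
  Nat.card_le_card_of_surjective _ (quotientMap_surjective h hf)

theorem card_quotient_lt_of_map [Finite α] {r : Setoid α} {s : Setoid β} {f : α → β}
    (h : r ≤ s.comap f) (hf : ∀ y, ∃ x, s (f x) y) {a b : α} (hab : ¬ r a b)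
    (hab' : s (f a) (f b)) : Nat.card (Quotient s) < Nat.card (Quotient r) := by
  refine (card_quotient_le_of_map h hf).lt_of_ne fun hcard => ?_
  have injective := ((Nat.bijective_iff_surjective_and_card _).2
    ⟨quotientMap_surjective h hf, hcard.symm⟩).injective
  exact hab (Quotient.exact (@injective ⟦a⟧ ⟦b⟧ (Quotient.sound hab')))

theorem card_quotient_le_of_le [Finite α] {r s : Setoid α} (h : r ≤ s) :
    Nat.card (Quotient s) ≤ Nat.card (Quotient r) :=
  card_quotient_le_of_map (f := id) h fun y => ⟨y, s.refl y⟩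

/-- The equivalence relation obtained from `s` by uniting the classes of `a` and `b`. -/
def glue (s : Setoid α) (a b : α) : Setoid α where
  r x y := s x y ∨ (s x a ∨ s x b) ∧ (s y a ∨ s y b)
  iseqv :=
    { refl := fun x => .inl (s.refl x)
      symm := fun h => h.imp s.symm And.symm
      trans := by
        rintro x y z (hxy | ⟨hx, hy⟩) (hyz | ⟨hy', hz⟩)
        · exact .inl (s.trans hxy hyz)
        · exact .inr ⟨hy'.imp (s.trans hxy) (s.trans hxy), hz⟩
        · exact .inr ⟨hx, hy.imp (s.trans (s.symm hyz)) (s.trans (s.symm hyz))⟩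
        · exact .inr ⟨hx, hz⟩ }

theorem le_glue (s : Setoid α) (a b : α) : s ≤ glue s a b := fun _ _ => .inl

theorem glue_left_right (s : Setoid α) (a b : α) : glue s a b a b :=
  .inr ⟨.inl (s.refl a), .inr (s.refl b)⟩

theorem glue_le {s r : Setoid α} {a b : α} (h : s ≤ r) (hab : r a b) : glue s a b ≤ r := by
  have eq_a : ∀ {x}, s x a ∨ s x b → r x a := by
    rintro x (hx | hx)
    exacts [h hx, r.trans (h hx) (r.symm hab)]
  rintro x y (hxy | ⟨hx, hy⟩)
  exacts [h hxy, r.trans (eq_a hx) (r.symm (eq_a hy))]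

theorem card_quotient_le_card_quotient_glue_add_one [Finite α] (s : Setoid α) (a b : α) :
    Nat.card (Quotient s) ≤ Nat.card (Quotient (glue s a b)) + 1 := by
  classical
  rw [← Finite.card_option]
  let drop : Quotient s → Option (Quotient (glue s a b)) := fun q =>
    if q = ⟦b⟧ then none else some (q.map id (le_glue s a b))
  refine Nat.card_le_card_of_injective drop ?_
  refine fun p q => Quotient.inductionOn₂ p q fun x y hxy => ?_
  by_cases hx : (⟦x⟧ : Quotient s) = ⟦b⟧ <;> by_cases hy : (⟦y⟧ : Quotient s) = ⟦b⟧
  · exact hx.trans hy.symm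
  · simp [drop, hx, hy] at hxy
  · simp [drop, hx, hy] at hxy
  · have hglue : glue s a b x y := Quotient.exact (by simpa [drop, hx, hy] using hxy)
    rw [Quotient.eq] at hx hy
    rcases hglue with h | ⟨hxa, hya⟩
    · exact Quotient.sound h
    · exact Quotient.sound (s.trans (hxa.resolve_right hx) (s.symm (hya.resolve_right hy)))

/-- The bipartite graph on the classes of `r` and of `c`, two classes being adjacent when they
meet. -/
def incidenceGraph (r c : Setoid α) : SimpleGraph (Quotient r ⊕ Quotient c) :=
  .fromRel fun p q => ∃ x : α, p = .inl ⟦x⟧ ∧ q = .inr ⟦x⟧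

theorem incidenceGraph_adj (r c : Setoid α) (x : α) :
    (incidenceGraph r c).Adj (.inl ⟦x⟧) (.inr ⟦x⟧) :=
  (SimpleGraph.fromRel_adj ..).2 ⟨Sum.inl_ne_inr, .inl ⟨x, rfl, rfl⟩⟩

theorem incidenceGraph_connected [Nonempty α] {r c : Setoid α} (h : r ⊔ c = ⊤) :
    (incidenceGraph r c).Connected := by
  let G := incidenceGraph r c
  have adj := incidenceGraph_adj r c
  let s : Setoid α := G.reachableSetoid.comap fun x => .inl ⟦x⟧
  have hr : r ≤ s := fun x y hxy => by
    change G.Reachable (.inl ⟦x⟧) (.inl ⟦y⟧)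
    rw [Quotient.sound hxy]
  have hc : c ≤ s := fun x y hxy => by
    change G.Reachable (.inl ⟦x⟧) (.inl ⟦y⟧)
    have := (adj y).symm.reachable
    rw [← Quotient.sound hxy] at this
    exact (adj x).reachable.trans this
  have reachable_inl : ∀ x y, G.Reachable (.inl ⟦x⟧) (.inl ⟦y⟧) := fun x y =>
    (h ▸ sup_le hr hc : ⊤ ≤ s) (x := x) (y := y) trivial
  inhabit α
  have reachable : ∀ p, G.Reachable (.inl ⟦default⟧) p := by
    rintro (⟨⟨x⟩⟩ | ⟨⟨x⟩⟩)
    exacts [reachable_inl _ x, (reachable_inl _ x).trans (adj x).reachable]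
  exact ⟨fun p q => (reachable p).symm.trans (reachable q)⟩

theorem card_quotient_add_card_quotient_le [Finite α] [Nonempty α] {r c b : Setoid α}
    (hr : b ≤ r) (hc : b ≤ c) (h : r ⊔ c = ⊤) :
    Nat.card (Quotient r) + Nat.card (Quotient c) ≤ Nat.card (Quotient b) + 1 := by
  let G := incidenceGraph r c
  have edges : Nat.card G.edgeSet ≤ Nat.card (Quotient b) := by
    let edge : Quotient b → G.edgeSet := fun q => q.lift
      (fun x => ⟨s(.inl ⟦x⟧, .inr ⟦x⟧), incidenceGraph_adj r c x⟩) fun x y hxy => by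
        simp only [Quotient.sound (hr hxy), Quotient.sound (hc hxy)]
    refine Nat.card_le_card_of_surjective edge ?_
    rintro ⟨e, he⟩
    induction e with | h p q
    rw [SimpleGraph.mem_edgeSet] at he
    obtain ⟨-, ⟨x, rfl, rfl⟩ | ⟨x, rfl, rfl⟩⟩ := (SimpleGraph.fromRel_adj ..).1 he
    exacts [⟨⟦x⟧, rfl⟩, ⟨⟦x⟧, Subtype.ext Sym2.eq_swap⟩]
  have := (incidenceGraph_connected h).card_vert_le_card_edgeSet_add_one
  rw [Nat.card_sum] at this
  exact this.trans (Nat.add_le_add_right edges 1)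

end Setoid

/-! ### Counting regions, components and tips -/

namespace Drawing

variable {D : Drawing t k} {a b : HalfEdge t k} {D' : Drawing t (k + 1)}

/-- The number of regions, the faces of the drawing. -/
noncomputable def numRegions (D : Drawing t k) : ℕ := Nat.card (Quotient D.region)

/-- The number of connected components of the drawing. Spots without half-edges are not counted. -/
noncomputable def numComponents (D : Drawing t k) : ℕ := Nat.card (Quotient D.component)

/-- The number of boundary components, summed over all regions. -/
noncomputable def numBoundaries (D : Drawing t k) : ℕ := Nat.card (Quotient D.boundary)

/-- The number of open tips. -/
noncomputable def numTips (D : Drawing t k) : ℕ := {d | D.IsTip d}.ncard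

theorem numRegions_le_numBoundaries : D.numRegions ≤ D.numBoundaries :=
  card_quotient_le_of_le boundary_le_region

theorem numBoundaries_le_numTips (h : ∀ d, ∃ e, D.IsTip e ∧ D.SameBoundary d e) :
    D.numBoundaries ≤ D.numTips := by
  refine Nat.card_le_card_of_surjective (fun e : {e // D.IsTip e} => ⟦e.1⟧) ?_
  refine Quotient.ind fun d => ?_
  obtain ⟨e, he, hde⟩ := h d
  exact ⟨⟨e, he⟩, Quotient.sound hde.symm⟩

namespace IsMove

theorem exists_old_sameBoundary (h : D.IsMove a b D') (x : HalfEdge t (k + 1)) :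
    ∃ d : HalfEdge t k, D'.SameBoundary d.old x := by
  induction x using cases_old_new with
  | old d => exact ⟨d, .refl ..⟩
  | new s =>
    rcases h.sameBoundary_new_new s with hs | hs
    exacts [⟨a, h.sameBoundary_left.trans hs.symm⟩, ⟨b, h.sameBoundary_right.trans hs.symm⟩]

theorem region_le_comap_proj (h : D.IsMove a b D') : D'.region ≤ D.region.comap (proj a) :=
  fun _ _ => h.region_proj

theorem component_le_comap_proj (h : D.IsMove a b D') (hab : D.component a b) :
    D'.component ≤ D.component.comap (proj a) := by
  refine component_le (fun x => ?_) fun x => ?_ <;> rw [Setoid.comap_rel] <;>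
    induction x using cases_old_new
  case old d => simpa only [rot_old, proj_old] using D.component_rot d
  case new r => simpa only [rot_new, proj_new] using D.component.refl a
  case old d =>
    rcases h.mate_old_cases d with ⟨rfl, hm⟩ | ⟨rfl, hm⟩ | ⟨-, -, hm⟩ <;>
      simp only [hm, proj_old, proj_new]
    exacts [D.component.refl d, D.component.symm hab, D.component_mate d]
  case new r =>
    have mate_one : D'.mate (new 1) = new 1 := h.isTip_new_one
    have mate_three : D'.mate (new 3) = new 3 := h.isTip_new_three
    fin_cases r <;> simp [h.mate_new_zero, h.mate_new_two, mate_one, mate_three, hab]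

theorem boundary_le_comap_old (h : D.IsMove a b D') :
    D.boundary ≤ (glue D'.boundary (new 1) (new 3)).comap old := by
  intro d e hde
  by_cases hd : D.SameBoundary d a ∨ D.SameBoundary d b
  · have he : D.SameBoundary e a ∨ D.SameBoundary e b :=
      hd.imp (SameBoundary.symm hde).trans (SameBoundary.symm hde).trans
    exact .inr ⟨h.sameBoundary_new hd, h.sameBoundary_new he⟩
  · rw [not_or] at hd
    exact .inl (h.sameBoundary_old hd.1 hd.2 hde)

theorem numRegions_le (h : D.IsMove a b D') : D.numRegions ≤ D'.numRegions :=
  card_quotient_le_of_map h.region_le_comap_proj fun d => ⟨d.old, by simp⟩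

theorem numRegions_lt (h : D.IsMove a b D') (hab : D.SameBoundary a b) :
    D.numRegions < D'.numRegions :=
  card_quotient_lt_of_map h.region_le_comap_proj (fun d => ⟨d.old, by simp⟩)
    (h.separates_iff.2 hab) (by simp)

theorem numComponents_le (h : D.IsMove a b D') (hab : D.component a b) :
    D.numComponents ≤ D'.numComponents :=
  card_quotient_le_of_map (h.component_le_comap_proj hab) fun d => ⟨d.old, by simp⟩

theorem numBoundaries_le (h : D.IsMove a b D') : D'.numBoundaries ≤ D.numBoundaries + 1 :=
  (card_quotient_le_card_quotient_glue_add_one _ (new 1) (new 3)).trans <| Nat.add_le_add_right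
    (card_quotient_le_of_map h.boundary_le_comap_old fun x =>
      (h.exists_old_sameBoundary x).imp fun _ => .inl) 1

theorem sameBoundary_new_one (h : D.IsMove a b D') {d : HalfEdge t k} (ha : D.SameBoundary d a)
    (hb : ¬ D.SameBoundary d b) : D'.SameBoundary d.old (new 1) := by
  obtain ⟨m, hm⟩ := ha
  induction m generalizing d with
  | zero => exact (show d = a from hm) ▸ h.sameBoundary_left
  | succ m ih =>
    by_cases hda : d = a
    · exact hda ▸ h.sameBoundary_left
    have next := SameBoundary.next D' d.old
    rw [h.next_old hda fun hdb => hb (hdb ▸ .refl ..)] at next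
    exact next.trans (ih (fun h' => hb ((SameBoundary.next D d).trans h')) hm)

theorem sameBoundary_one_three (h : D.IsMove a b D') (hab : ¬ D.SameBoundary a b) :
    D'.SameBoundary (new 1) (new 3) := by
  have next := SameBoundary.next D a
  have zero_next : D'.SameBoundary (new 0) (D.next a).old := ⟨1, h.next_new_zero⟩
  exact ((h.sameBoundary_three_zero.trans zero_next).trans
    (h.sameBoundary_new_one next.symm fun h' => hab (next.trans h'))).symm

theorem numBoundaries_lt (h : D.IsMove a b D') (hab : ¬ D.SameBoundary a b) :
    D'.numBoundaries < D.numBoundaries := by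
  have one_three := h.sameBoundary_one_three hab
  have hglue : glue D'.boundary (new 1) (new 3) ≤ D'.boundary := glue_le le_rfl one_three
  exact card_quotient_lt_of_map (f := old) (fun _ _ hde => hglue (h.boundary_le_comap_old hde))
    h.exists_old_sameBoundary hab
    ((h.sameBoundary_left.trans one_three).trans h.sameBoundary_right.symm)

theorem region_sup_component (h : D.IsMove a b D') (hD : D.region ⊔ D.component = ⊤) :
    D'.region ⊔ D'.component = ⊤ := by
  let s := D'.region ⊔ D'.component
  have region_le : D'.region ≤ s := le_sup_left
  have component_le : D'.component ≤ s := le_sup_right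
  have new_of_region : ∀ d, D.region a d → s d.old (new 1) := by
    intro d had
    rcases h.region_split d had with h1 | h3
    · exact s.symm (region_le h1)
    · exact s.trans (s.symm (region_le h3)) (component_le (component_of_vertex_eq rfl))
  have hregion : D.region ≤ s.comap old := by
    intro d e hde
    by_cases had : D.region a d
    · exact s.trans (new_of_region d had) (s.symm (new_of_region e (D.region.trans had hde)))
    · exact region_le (h.region_persists d e had hde)
  have hcomponent : D.component ≤ s.comap old := by
    refine Drawing.component_le (fun d => ?_) fun d => ?_ <;> rw [Setoid.comap_rel]
    · rw [← rot_old]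
      exact component_le (D'.component_rot _)
    · rcases h.mate_old_cases d with ⟨rfl, -⟩ | ⟨rfl, -⟩ | ⟨-, -, hm⟩
      · rw [h.isTip_left]
      · rw [h.isTip_right]
      · rw [← hm]
        exact component_le (D'.component_mate _)
  have old_old : ∀ d e : HalfEdge t k, s d.old e.old := fun d e =>
    (hD ▸ sup_le hregion hcomponent : ⊤ ≤ s.comap old) (x := d) (y := e) trivial
  refine eq_top_iff.2 fun x y _ => ?_
  obtain ⟨d, hd⟩ := h.exists_old_sameBoundary x
  obtain ⟨e, he⟩ := h.exists_old_sameBoundary y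
  exact s.trans (s.symm (region_le hd.region)) (s.trans (old_old d e) (region_le he.region))

theorem exists_isTip_sameBoundary (h : D.IsMove a b D')
    (hD : ∀ d, ∃ e, D.IsTip e ∧ D.SameBoundary d e) (x : HalfEdge t (k + 1)) :
    ∃ y, D'.IsTip y ∧ D'.SameBoundary x y := by
  obtain ⟨d, hd⟩ := h.exists_old_sameBoundary x
  by_cases hab : D.SameBoundary d a ∨ D.SameBoundary d b
  · rcases h.sameBoundary_new hab with h1 | h3
    exacts [⟨_, h.isTip_new_one, hd.symm.trans h1⟩, ⟨_, h.isTip_new_three, hd.symm.trans h3⟩]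
  · rw [not_or] at hab
    obtain ⟨e, he, hde⟩ := hD d
    refine ⟨e.old, h.isTip_old.2 ⟨he, ?_, ?_⟩, hd.symm.trans (h.sameBoundary_old hab.1 hab.2 hde)⟩
    exacts [fun hea => hab.1 (hea ▸ hde), fun heb => hab.2 (heb ▸ hde)]

theorem numTips_eq (h : D.IsMove a b D') : D'.numTips = D.numTips := by
  have joined : ({a, b} : Set (HalfEdge t k)) ⊆ {d | D.IsTip d} :=
    Set.insert_subset h.isTip_left (Set.singleton_subset_iff.2 h.isTip_right)
  have tips : {x | D'.IsTip x} = old '' ({d | D.IsTip d} \ {a, b}) ∪ {new 1, new 3} := by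
    ext x
    induction x using cases_old_new with
    | old d => simp [h.isTip_old, old_injective.mem_set_image]
    | new s => simp [h.isTip_new]
  have disjoint : Disjoint (old '' ({d | D.IsTip d} \ {a, b})) {new 1, new 3} :=
    Set.disjoint_left.2 (by rintro _ ⟨d, -, rfl⟩; simp)
  calc {x | D'.IsTip x}.ncard
      = ({d | D.IsTip d} \ {a, b}).ncard + 2 := by
        rw [tips, Set.ncard_union_eq disjoint, Set.ncard_image_of_injective _ old_injective,
          Set.ncard_pair (by simp)]
    _ = {d | D.IsTip d}.ncard := by
        rw [← Set.ncard_pair h.ne, Set.ncard_sdiff_add_ncard_of_subset joined]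

end IsMove

end Drawing

/-! ### Cutting edges, and the Euler inequality -/

namespace Drawing

variable {D : Drawing t k} {u d : HalfEdge t k}

theorem next_mate (D : Drawing t k) (d : HalfEdge t k) : D.next (D.mate d) = d.rot :=
  congrArg rot (D.mate_mate d)

/-- The drawing in which the edge containing `u` is cut into two open tips. Only the boundary
components of a cut drawing are of interest; its regions are forgotten. -/
def cut (D : Drawing t k) (u : HalfEdge t k) : Drawing t k :=
  open scoped Classical in
  { mate := fun d => if d = u ∨ d = D.mate u then d else D.mate d
    mate_mate := fun d => by
      by_cases hd : d = u ∨ d = D.mate u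
      · simp only [if_pos hd]
      · have hd' : ¬ (D.mate d = u ∨ D.mate d = D.mate u) := by
          rintro (h | h)
          · exact hd (.inr (by rw [← h, D.mate_mate]))
          · exact hd (.inl (by rw [← D.mate_mate d, h, D.mate_mate]))
        rw [if_neg hd, if_neg hd', D.mate_mate]
    region := ⊤
    region_rot_mate := fun _ => trivial }

theorem mate_cut_of_ne (hu : d ≠ u) (hm : d ≠ D.mate u) : (D.cut u).mate d = D.mate d :=
  if_neg (by simp only [hu, hm, or_self, not_false_eq_true])

theorem isTip_cut : (D.cut u).IsTip d ↔ D.IsTip d ∨ d = u ∨ d = D.mate u := by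
  by_cases h : d = u ∨ d = D.mate u
  · exact iff_of_true (if_pos h) (.inr h)
  · rw [not_or] at h
    simp only [IsTip, mate_cut_of_ne h.1 h.2, h, or_self, or_false]

theorem not_isTip_cut : ¬ (D.cut u).IsTip d ↔ ¬ D.IsTip d ∧ d ≠ u ∧ d ≠ D.mate u := by
  rw [isTip_cut, not_or, not_or]

theorem isTip_cut_self (D : Drawing t k) (u : HalfEdge t k) : (D.cut u).IsTip u :=
  isTip_cut.2 (.inr (.inl rfl))

theorem isTip_cut_mate (D : Drawing t k) (u : HalfEdge t k) : (D.cut u).IsTip (D.mate u) :=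
  isTip_cut.2 (.inr (.inr rfl))

theorem next_cut_of_ne (hu : d ≠ u) (hm : d ≠ D.mate u) : (D.cut u).next d = D.next d :=
  congrArg rot (mate_cut_of_ne hu hm)

theorem next_cut_self (D : Drawing t k) (u : HalfEdge t k) :
    (D.cut u).next u = D.next (D.mate u) := by
  rw [(D.isTip_cut_self u).next_eq, next_mate]

theorem next_cut_mate (D : Drawing t k) (u : HalfEdge t k) :
    (D.cut u).next (D.mate u) = D.next u :=
  (D.isTip_cut_mate u).next_eq

theorem boundary_cut_le_glue (D : Drawing t k) (u : HalfEdge t k) :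
    (D.cut u).boundary ≤ glue D.boundary u (D.mate u) := by
  let s := glue D.boundary u (D.mate u)
  have next : ∀ d, s d (D.next d) := fun d => .inl (.next D d)
  have glued : s u (D.mate u) := glue_left_right ..
  refine boundary_le fun d => ?_
  by_cases hu : d = u
  · subst hu
    exact next_cut_self D d ▸ s.trans glued (next _)
  by_cases hm : d = D.mate u
  · subst hm
    exact next_cut_mate D u ▸ s.trans (s.symm glued) (next _)
  · exact next_cut_of_ne hu hm ▸ next d

theorem boundary_le_glue_cut (D : Drawing t k) (u : HalfEdge t k) :
    D.boundary ≤ glue (D.cut u).boundary u (D.mate u) := by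
  let s := glue (D.cut u).boundary u (D.mate u)
  have next : ∀ d, s d ((D.cut u).next d) := fun d => .inl (.next (D.cut u) d)
  have glued : s u (D.mate u) := glue_left_right ..
  refine boundary_le fun d => ?_
  by_cases hu : d = u
  · subst hu
    exact next_cut_mate D d ▸ s.trans glued (next _)
  by_cases hm : d = D.mate u
  · subst hm
    exact next_cut_self D u ▸ s.trans (s.symm glued) (next _)
  · exact next_cut_of_ne hu hm ▸ next d

theorem component_le_glue_cut (D : Drawing t k) (u : HalfEdge t k) :
    D.component ≤ glue (D.cut u).component u (D.mate u) := by
  let s := glue (D.cut u).component u (D.mate u)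
  have glued : s u (D.mate u) := glue_left_right ..
  refine component_le (fun d => .inl ((D.cut u).component_rot d)) fun d => ?_
  by_cases hu : d = u
  · subst hu
    exact glued
  by_cases hm : d = D.mate u
  · rw [hm, D.mate_mate]
    exact s.symm glued
  · exact mate_cut_of_ne hu hm ▸ .inl ((D.cut u).component_mate d)

theorem boundary_cut_le (h : D.SameBoundary u (D.mate u)) : (D.cut u).boundary ≤ D.boundary :=
  (boundary_cut_le_glue D u).trans (glue_le le_rfl h)

theorem SameBoundary.of_cut (h : D.SameBoundary u (D.mate u)) {d e : HalfEdge t k}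
    (hde : (D.cut u).SameBoundary d e) : D.SameBoundary d e :=
  boundary_cut_le h hde

theorem not_sameBoundary_cut (hu : ¬ D.IsTip u) (h : D.SameBoundary u (D.mate u)) :
    ¬ (D.cut u).SameBoundary u (D.mate u) := by
  have hne : u ≠ D.mate u := Ne.symm hu
  have hle : (D.cut u).boundary ≤ Setoid.ker (D.ReachesFirst u (D.mate u)) := by
    refine boundary_le fun d => propext ?_
    by_cases hdu : d = u
    · subst hdu
      rw [next_cut_self]
      exact iff_of_true (reachesFirst_self hne) (reachesFirst_next_right hne h)
    by_cases hdm : d = D.mate u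
    · subst hdm
      rw [next_cut_mate]
      exact iff_of_false not_reachesFirst_self (not_reachesFirst_next_left h)
    · rw [next_cut_of_ne hdu hdm]
      exact (reachesFirst_next hdu hdm).symm
  intro h'
  exact not_reachesFirst_self (b := D.mate u) (Eq.mp (hle h') (reachesFirst_self hne))

theorem sameBoundary_cut_of_not (h : ¬ D.SameBoundary u (D.mate u)) :
    (D.cut u).SameBoundary u (D.mate u) := by
  have reaches_u : ∀ m d, D.next^[m] d = u → ¬ D.SameBoundary d (D.mate u) →
      (D.cut u).SameBoundary d u := by
    intro m
    induction m with
    | zero => rintro d rfl -; exact .refl ..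
    | succ m ih =>
      intro d hm hd
      by_cases hdu : d = u
      · exact hdu ▸ .refl ..
      have next := SameBoundary.next (D.cut u) d
      rw [next_cut_of_ne hdu fun hdm => hd (hdm ▸ .refl ..)] at next
      exact next.trans (ih _ hm fun h' => hd ((SameBoundary.next D d).trans h'))
  have u_next := SameBoundary.next D u
  obtain ⟨m, hm⟩ := u_next.symm
  have mate_next := SameBoundary.next (D.cut u) (D.mate u)
  rw [next_cut_mate] at mate_next
  exact (mate_next.trans (reaches_u m _ hm fun h' => h (u_next.trans h'))).symm

theorem numBoundaries_le_cut (D : Drawing t k) (u : HalfEdge t k) :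
    D.numBoundaries ≤ (D.cut u).numBoundaries + 1 :=
  (card_quotient_le_card_quotient_glue_add_one ..).trans
    (Nat.add_le_add_right (card_quotient_le_of_le (boundary_cut_le_glue D u)) 1)

theorem numBoundaries_lt_cut (hu : ¬ D.IsTip u) (h : D.SameBoundary u (D.mate u)) :
    D.numBoundaries < (D.cut u).numBoundaries :=
  card_quotient_lt_of_map (f := id) (boundary_cut_le h) (fun d => ⟨d, .refl D d⟩)
    (not_sameBoundary_cut hu h) h

theorem numComponents_cut_le_add_one (D : Drawing t k) (u : HalfEdge t k) :
    (D.cut u).numComponents ≤ D.numComponents + 1 :=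
  (card_quotient_le_card_quotient_glue_add_one ..).trans
    (Nat.add_le_add_right (card_quotient_le_of_le (component_le_glue_cut D u)) 1)

theorem numComponents_cut_le (h : (D.cut u).component u (D.mate u)) :
    (D.cut u).numComponents ≤ D.numComponents :=
  card_quotient_le_of_le ((component_le_glue_cut D u).trans (glue_le le_rfl h))

theorem numTips_cut (hu : ¬ D.IsTip u) : (D.cut u).numTips = D.numTips + 2 := by
  have tips : {d | (D.cut u).IsTip d} = {d | D.IsTip d} ∪ {u, D.mate u} := by
    ext d
    exact isTip_cut
  have disjoint : Disjoint {d | D.IsTip d} {u, D.mate u} := by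
    rw [Set.disjoint_left]
    rintro d hd (rfl | rfl)
    exacts [hu hd, hu (isTip_mate.1 hd)]
  rw [numTips, tips, Set.ncard_union_eq disjoint, Set.ncard_pair (Ne.symm hu), numTips]

theorem numBoundaries_le_of_forall_isTip (h : ∀ d, D.IsTip d) :
    D.numBoundaries ≤ n + k := by
  have hle : Setoid.ker vertex ≤ D.boundary := fun d e hde => by
    obtain ⟨m, hm⟩ := exists_rot_iterate hde
    exact ⟨m, by rwa [show D.next = rot from funext fun d => (h d).next_eq]⟩
  calc D.numBoundaries ≤ Nat.card (Quotient (Setoid.ker (vertex (t := t) (k := k)))) :=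
        card_quotient_le_of_le hle
    _ ≤ Nat.card (Vertex n k) :=
        Nat.card_le_card_of_injective _ (Setoid.kerLift_injective vertex)
    _ = n + k := by simp

theorem le_numComponents_of_forall_isTip (ht : ∀ i, 0 < t i) (h : ∀ d, D.IsTip d) :
    n + k ≤ D.numComponents := by
  have hle : D.component ≤ Setoid.ker vertex :=
    component_le (fun d => (vertex_rot d).symm) fun d => congrArg vertex (h d).symm
  have surjective : Function.Surjective (vertex : HalfEdge t k → Vertex n k) := by
    rintro (i | j)
    exacts [⟨.inl ⟨i, 0, ht i⟩, rfl⟩, ⟨.inr (j, 0), rfl⟩]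
  calc n + k = Nat.card (Vertex n k) := by simp
    _ ≤ D.numComponents :=
        Nat.card_le_card_of_surjective (Quotient.lift vertex fun _ _ h => hle h)
          (Quotient.lift_surjective _ _ surjective)

theorem numTips_of_forall_isTip (h : ∀ d, D.IsTip d) : D.numTips = ∑ i, t i + 4 * k := by
  rw [numTips, Set.eq_univ_of_forall (s := {d | D.IsTip d}) h, Set.ncard_univ,
    Nat.card_eq_fintype_card]
  simp [mul_comm]

-- Twice the inequality `V - E + F ≤ 2 C`, where `2 E` is the number of half-edges that are not
-- tips: cutting the edges one by one does not decrease `V - E + F - 2 C`, which finally is `0`.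
theorem euler_inequality (ht : ∀ i, 0 < t i) (D : Drawing t k) :
    2 * D.numBoundaries + 2 * n + D.numTips ≤ ∑ i, t i + 2 * k + 4 * D.numComponents := by
  by_cases htips : ∀ d, D.IsTip d
  · have := numBoundaries_le_of_forall_isTip htips
    have := le_numComponents_of_forall_isTip ht htips
    have := numTips_of_forall_isTip htips
    omega
  · obtain ⟨u, hu⟩ := not_forall.1 htips
    have tips := numTips_cut hu
    have : (D.cut u).numTips ≤ Nat.card (HalfEdge t k) := Set.ncard_le_card _
    have ih := euler_inequality ht (D.cut u)
    by_cases h : D.SameBoundary u (D.mate u)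
    · have := numBoundaries_lt_cut hu h
      have := numComponents_cut_le_add_one D u
      omega
    · have := numBoundaries_le_cut D u
      have := numComponents_cut_le (sameBoundary_cut_of_not h).component
      omega
termination_by Nat.card (HalfEdge t k) - D.numTips
decreasing_by omega

/-- Equality holds in Euler's inequality, that is, the drawing has genus zero. -/
def Planar (D : Drawing t k) : Prop :=
  ∑ i, t i + 2 * k + 4 * D.numComponents ≤ 2 * D.numBoundaries + 2 * n + D.numTips

/-- Cutting the edge containing `u` disconnects its two halves. -/
def IsBridge (D : Drawing t k) (u : HalfEdge t k) : Prop :=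
  ¬ (D.cut u).component u (D.mate u)

theorem Planar.cut (hD : D.Planar) (hu : ¬ D.IsTip u) (h : D.SameBoundary u (D.mate u)) :
    (D.cut u).Planar := by
  have := numTips_cut hu
  have := numBoundaries_lt_cut hu h
  have := numComponents_cut_le_add_one D u
  unfold Planar at *
  omega

theorem Planar.isBridge (ht : ∀ i, 0 < t i) (hD : D.Planar) (hu : ¬ D.IsTip u)
    (h : D.SameBoundary u (D.mate u)) : D.IsBridge u := by
  intro hcomp
  have := euler_inequality ht (D.cut u)
  have := numTips_cut hu
  have := numBoundaries_lt_cut hu h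
  have := numComponents_cut_le hcomp
  unfold Planar at hD
  omega

/-- The half-edges that remain connected with `u` when the edge containing `u` is cut. -/
def side (D : Drawing t k) (u : HalfEdge t k) : Set (HalfEdge t k) :=
  {d | (D.cut u).component u d}

theorem self_mem_side (D : Drawing t k) (u : HalfEdge t k) : u ∈ D.side u :=
  (D.cut u).component.refl u

theorem mem_side_congr {d e : HalfEdge t k} (h : (D.cut u).component d e) :
    d ∈ D.side u ↔ e ∈ D.side u :=
  ⟨fun hd => (D.cut u).component.trans hd h, fun he => (D.cut u).component.trans he
    ((D.cut u).component.symm h)⟩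

theorem mem_side_of_vertex_eq {d e : HalfEdge t k} (h : d.vertex = e.vertex) :
    d ∈ D.side u ↔ e ∈ D.side u :=
  mem_side_congr (component_of_vertex_eq h)

theorem mate_mem_side (hu : d ≠ u) (hm : d ≠ D.mate u) :
    D.mate d ∈ D.side u ↔ d ∈ D.side u := by
  rw [← mate_cut_of_ne hu hm]
  exact (mem_side_congr ((D.cut u).component_mate d)).symm

theorem IsBridge.sameBoundary_cut (hu : D.IsBridge u) {d e : HalfEdge t k} (hd : d ∈ D.side u)
    (he : e ∈ D.side u) (h : D.SameBoundary d e) : (D.cut u).SameBoundary d e := by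
  have sameBoundary_self : ∀ {x}, x ∈ D.side u →
      (D.cut u).SameBoundary x u ∨ (D.cut u).SameBoundary x (D.mate u) →
      (D.cut u).SameBoundary x u := fun hx h =>
    h.resolve_right fun hm => hu ((D.cut u).component.trans hx hm.component)
  rcases boundary_le_glue_cut D u h with h | ⟨hd', he'⟩
  exacts [h, (sameBoundary_self hd hd').trans (sameBoundary_self he he').symm]

theorem Adj.of_cut {x y : Vertex n k} (h : (D.cut u).Adj x y) : D.Adj x y := by
  obtain ⟨d, hd, hx, hy⟩ := h
  rw [not_isTip_cut] at hd
  exact ⟨d, hd.1, hx, mate_cut_of_ne hd.2.1 hd.2.2 ▸ hy⟩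

theorem Sparse.cut (hD : D.Sparse) (u : HalfEdge t k) : (D.cut u).Sparse where
  not_adj_self x hx := hD.not_adj_self x hx.of_cut
  eq_of_vertex d e hd he hv hm := by
    rw [not_isTip_cut] at hd he
    rw [mate_cut_of_ne hd.2.1 hd.2.2, mate_cut_of_ne he.2.1 he.2.2] at hm
    exact hD.eq_of_vertex d e hd.1 he.1 hv hm
  no_triangle x y z hxy hyz hzx := hD.no_triangle x y z hxy.of_cut hyz.of_cut hzx.of_cut

end Drawing

/-! ### Estimates for reachable drawings -/

namespace Drawing

theorem numTips_start : (start t).numTips = ∑ i, t i :=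
  numTips_of_forall_isTip fun _ => rfl

theorem numBoundaries_start_le : (start t).numBoundaries ≤ n :=
  numBoundaries_le_of_forall_isTip fun _ => rfl

end Drawing

namespace Reachable

open Drawing

variable {F : ∀ {α β : Type}, Graph α β → Prop} {D : Drawing t k}

theorem region_sup_component (hD : Reachable F t k D) : D.region ⊔ D.component = ⊤ := by
  induction hD with
  | start => exact top_sup_eq _
  | move _ h _ ih => exact h.region_sup_component ih

theorem exists_isTip_sameBoundary (hD : Reachable F t k D) :
    ∀ d, ∃ e, D.IsTip e ∧ D.SameBoundary d e := by
  induction hD with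
  | start => exact fun d => ⟨d, rfl, .refl ..⟩
  | move _ h _ ih => exact h.exists_isTip_sameBoundary ih

theorem numTips_eq (hD : Reachable F t k D) : D.numTips = ∑ i, t i := by
  induction hD with
  | start => exact numTips_start
  | move _ h _ ih => exact h.numTips_eq.trans ih

theorem add_numBoundaries_add_two_le (hn : 0 < n) (ht : ∀ i, 0 < t i) (hD : Reachable F t k D) :
    k + D.numBoundaries + 2 ≤ n + 2 * D.numRegions := by
  induction hD with
  | start =>
    have : Nonempty (Quotient (Drawing.start t).region) := ⟨⟦.inl ⟨⟨0, hn⟩, 0, ht _⟩⟧⟩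
    have numRegions_pos : 0 < (Drawing.start t).numRegions := Nat.card_pos
    have := numBoundaries_start_le (t := t)
    omega
  | @move k D D' a b _ h _ ih =>
    by_cases hab : D.SameBoundary a b
    · have := h.numBoundaries_le
      have := h.numRegions_lt hab
      omega
    · have := h.numBoundaries_lt hab
      have := h.numRegions_le
      omega

theorem add_two_le (hn : 0 < n) (ht : ∀ i, 0 < t i) (hD : Reachable F t k D) :
    k + 2 ≤ n + ∑ i, t i := by
  have := hD.add_numBoundaries_add_two_le hn ht
  have := numRegions_le_numBoundaries (D := D)
  have := numBoundaries_le_numTips hD.exists_isTip_sameBoundary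
  have := hD.numTips_eq
  omega

theorem numRegions_add_numComponents_le (hn : 0 < n) (ht : ∀ i, 0 < t i)
    (hD : Reachable F t k D) : D.numRegions + D.numComponents ≤ D.numBoundaries + 1 := by
  have : Nonempty (HalfEdge t k) := ⟨.inl ⟨⟨0, hn⟩, 0, ht _⟩⟩
  exact card_quotient_add_card_quotient_le boundary_le_region boundary_le_component
    hD.region_sup_component

theorem planar (hn : 0 < n) (ht : ∀ i, 0 < t i) (hD : Reachable F t k D) : D.Planar := by
  have := hD.add_numBoundaries_add_two_le hn ht
  have := hD.numRegions_add_numComponents_le hn ht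
  have := hD.numTips_eq
  unfold Planar
  omega

theorem numBoundaries_add_le (ht : ∀ i, 0 < t i) (hD : Reachable F t k D) :
    D.numBoundaries + n ≤ k + 2 * D.numComponents := by
  have := euler_inequality ht D
  have := hD.numTips_eq
  omega

-- Otherwise joining `a` and `b` would merge two boundary components, but neither regions nor
-- components of the drawing, leaving too few boundary components to connect these with each other.
theorem not_component (hn : 0 < n) (ht : ∀ i, 0 < t i) (hD : Reachable F t k D)
    {a b : HalfEdge t k} (ha : D.IsTip a) (hb : D.IsTip b) (hr : D.region a b)
    (hab : ¬ D.SameBoundary a b) : ¬ D.component a b := by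
  intro hcomp
  obtain ⟨D', h⟩ := exists_isMove ha hb (fun hab' => hab (hab' ▸ .refl ..)) hr
  have := h.numRegions_le
  have := h.numComponents_le hcomp
  have := h.numBoundaries_lt hab
  have : Nonempty (HalfEdge t (k + 1)) := ⟨new 0⟩
  have : D'.numRegions + D'.numComponents ≤ D'.numBoundaries + 1 :=
    card_quotient_add_card_quotient_le boundary_le_region boundary_le_component
      (h.region_sup_component hD.region_sup_component)
  have := hD.add_numBoundaries_add_two_le hn ht
  have := hD.numBoundaries_add_le ht
  omega

end Reachable

/-! ### The order in which the vertices are drawn -/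

namespace HalfEdge

/-- The time at which the vertex of a half-edge was drawn; `0` for the initial spots. -/
def time (d : HalfEdge t k) : ℕ := Sum.elim (fun _ => 0) (fun d => d.1.val + 1) d

/-- The half-edge is one of the two halves of the curve on which its vertex was drawn. -/
def IsDown (d : HalfEdge t k) : Prop := Sum.elim (fun _ => False) (fun d => d.2 = 0 ∨ d.2 = 2) d

variable {x y : HalfEdge t k}

theorem time_eq_of_vertex (h : x.vertex = y.vertex) : x.time = y.time := by
  rcases x with ⟨i, p⟩ | ⟨j, s⟩ <;> rcases y with ⟨i', q⟩ | ⟨j', s'⟩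
  · rfl
  · cases h
  · cases h
  · cases h; rfl

theorem time_le (x : HalfEdge t k) : x.time ≤ k := by
  rcases x with _ | ⟨j, _⟩
  exacts [Nat.zero_le _, j.2]

@[simp] theorem time_rot (x : HalfEdge t k) : x.rot.time = x.time :=
  time_eq_of_vertex (vertex_rot x)

theorem time_old (x : HalfEdge t k) : x.old.time = x.time := by
  rcases x with ⟨i, p⟩ | ⟨j, s⟩ <;> rfl

theorem time_new (s : Fin 4) : (new s : HalfEdge t (k + 1)).time = k + 1 := rfl

theorem isDown_old : x.old.IsDown ↔ x.IsDown := by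
  rcases x with ⟨i, p⟩ | ⟨j, s⟩ <;> rfl

theorem isDown_new {s : Fin 4} : (new s : HalfEdge t (k + 1)).IsDown ↔ s = 0 ∨ s = 2 := Iff.rfl

theorem IsDown.time_ne (h : x.IsDown) : x.time ≠ 0 := by
  rcases x with ⟨i, p⟩ | ⟨j, s⟩
  exacts [h.elim, Nat.succ_ne_zero _]

theorem not_isDown_of_time (h : x.time = 0) : ¬ x.IsDown := fun hx => hx.time_ne h

theorem isDown_rot (h : x.time ≠ 0) : x.rot.IsDown ↔ ¬ x.IsDown := by
  rcases x with ⟨i, p⟩ | ⟨j, s⟩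
  · exact absurd rfl h
  · have : ∀ s : Fin 4, (s + 1 = 0 ∨ s + 1 = 2) ↔ ¬ (s = 0 ∨ s = 2) := by decide
    exact this s

theorem rot_rot_rot_rot (h : x.time ≠ 0) : x.rot.rot.rot.rot = x := by
  rcases x with ⟨i, p⟩ | ⟨j, s⟩
  · exact absurd rfl h
  · have : ∀ s : Fin 4, s + 1 + 1 + 1 + 1 = s := by decide
    exact congrArg (fun s' => Sum.inr (j, s')) (this s)

theorem rot_rot_ne (h : x.time ≠ 0) : x.rot.rot ≠ x := by
  rcases x with ⟨i, p⟩ | ⟨j, s⟩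
  · exact absurd rfl h
  · have : ∀ s : Fin 4, s + 1 + 1 ≠ s := by decide
    exact fun h' => this s (Prod.ext_iff.1 (Sum.inr.inj h')).2

theorem eq_or_eq_rot_rot (h : x.time ≠ 0) (hxy : x.vertex = y.vertex)
    (hd : x.IsDown ↔ y.IsDown) : y = x ∨ y = x.rot.rot := by
  rcases x with ⟨i, p⟩ | ⟨j, s⟩
  · exact absurd rfl h
  rcases y with ⟨i, p⟩ | ⟨j', s'⟩
  · cases hxy
  cases hxy
  have : ∀ s s' : Fin 4, ((s = 0 ∨ s = 2) ↔ (s' = 0 ∨ s' = 2)) → s' = s ∨ s' = s + 1 + 1 := by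
    decide
  rcases this s s' hd with rfl | rfl
  exacts [.inl rfl, .inr rfl]

theorem eq_rot_or_eq_rot (h : x.time ≠ 0) (hxy : x.vertex = y.vertex)
    (hd : x.IsDown ↔ ¬ y.IsDown) : y = x.rot ∨ x = y.rot := by
  rcases eq_or_eq_rot_rot (x := x.rot) (y := y) (by rwa [time_rot]) (by rwa [vertex_rot])
    (by rw [isDown_rot h, hd, not_not]) with hy | hy
  · exact .inl hy
  · exact .inr (by rw [hy, rot_rot_rot_rot h])

theorem rot_ne (ht : ∀ i, 2 ≤ t i) (h : x.time = 0) : x.rot ≠ x := by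
  rcases x with ⟨i, p⟩ | ⟨j, s⟩
  · intro h'
    obtain ⟨N, hN⟩ := Nat.exists_eq_add_of_le' (ht i)
    have hp : finRotate (t i) p = p := by simpa [rot] using h'
    have hsupport := support_finRotate (n := N)
    rw [← hN] at hsupport
    exact Equiv.Perm.mem_support.1 (hsupport ▸ Finset.mem_univ p) hp
  · exact absurd h (Nat.succ_ne_zero _)

end HalfEdge

namespace Drawing

variable {D : Drawing t k}

/-- Each edge joins a half of the curve of a crossbar to an older vertex. -/
structure Timed (D : Drawing t k) : Prop where
  isDown_mate : ∀ d, ¬ D.IsTip d → ((D.mate d).IsDown ↔ ¬ d.IsDown)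
  time_mate_lt : ∀ d, d.IsDown → ¬ D.IsTip d → (D.mate d).time < d.time

namespace IsMove

variable {D' : Drawing t (k + 1)} {a b : HalfEdge t k}

theorem not_isTip_of_isDown (h : D.IsMove a b D') (hdown : ∀ d, d.IsDown → ¬ D.IsTip d) :
    ∀ d, d.IsDown → ¬ D'.IsTip d := by
  intro x hx htip
  induction x using cases_old_new with
  | old d => exact hdown d (isDown_old.1 hx) (h.isTip_old.1 htip).1
  | new s =>
    rw [h.isTip_new] at htip
    rcases isDown_new.1 hx with rfl | rfl <;> simp at htip

theorem isDown_mate (h : D.IsMove a b D') (hD : D.Timed) (hdown : ∀ d, d.IsDown → ¬ D.IsTip d)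
    (x : HalfEdge t (k + 1)) (hx : ¬ D'.IsTip x) : (D'.mate x).IsDown ↔ ¬ x.IsDown := by
  have ha : ¬ a.IsDown := fun hd => hdown a hd h.isTip_left
  have hb : ¬ b.IsDown := fun hd => hdown b hd h.isTip_right
  induction x using cases_old_new with
  | old d =>
    rw [h.isTip_old] at hx
    rcases h.mate_old_cases d with ⟨rfl, hm⟩ | ⟨rfl, hm⟩ | ⟨hda, hdb, hm⟩
    · simp [hm, isDown_old, isDown_new, ha]
    · simp [hm, isDown_old, isDown_new, hb]
    · rw [hm, isDown_old, isDown_old, hD.isDown_mate d fun hd => hx ⟨hd, hda, hdb⟩]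
  | new s =>
    rw [h.isTip_new] at hx
    fin_cases s
    · simp [h.mate_new_zero, isDown_old, isDown_new, ha]
    · simp at hx
    · simp [h.mate_new_two, isDown_old, isDown_new, hb]
    · simp at hx

theorem time_mate_lt (h : D.IsMove a b D') (hD : D.Timed)
    (hdown : ∀ d, d.IsDown → ¬ D.IsTip d) (x : HalfEdge t (k + 1)) (hx : x.IsDown) :
    (D'.mate x).time < x.time := by
  induction x using cases_old_new with
  | old d =>
    have hd := isDown_old.1 hx
    have hda : d ≠ a := fun hda => hdown d hd (hda ▸ h.isTip_left)
    have hdb : d ≠ b := fun hdb => hdown d hd (hdb ▸ h.isTip_right)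
    rw [h.mate_old d hda hdb, time_old, time_old]
    exact hD.time_mate_lt d hd (hdown d hd)
  | new s =>
    rcases isDown_new.1 hx with rfl | rfl
    · rw [h.mate_new_zero, time_old, time_new]
      exact Nat.lt_succ_of_le a.time_le
    · rw [h.mate_new_two, time_old, time_new]
      exact Nat.lt_succ_of_le b.time_le

theorem timed (h : D.IsMove a b D') (hD : D.Timed) (hdown : ∀ d, d.IsDown → ¬ D.IsTip d) :
    D'.Timed :=
  ⟨h.isDown_mate hD hdown, fun x hx _ => h.time_mate_lt hD hdown x hx⟩

end IsMove

namespace Timed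

variable {x y : HalfEdge t k}

theorem cut (h : D.Timed) (u : HalfEdge t k) : (D.cut u).Timed where
  isDown_mate d hd := by
    rw [not_isTip_cut] at hd
    rw [mate_cut_of_ne hd.2.1 hd.2.2]
    exact h.isDown_mate d hd.1
  time_mate_lt d hdown hd := by
    rw [not_isTip_cut] at hd
    rw [mate_cut_of_ne hd.2.1 hd.2.2]
    exact h.time_mate_lt d hdown hd.1

theorem isDown_mate_of_not (h : D.Timed) (hx : ¬ x.IsDown) (htip : ¬ D.IsTip x) :
    (D.mate x).IsDown :=
  (h.isDown_mate x htip).2 hx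

theorem not_isDown_mate (h : D.Timed) (hx : x.IsDown) (htip : ¬ D.IsTip x) :
    ¬ (D.mate x).IsDown := fun hm => (h.isDown_mate x htip).1 hm hx

theorem not_adj_of_time (h : D.Timed) (hx : x.time = 0) (hy : y.time = 0) :
    ¬ D.Adj x.vertex y.vertex := by
  rintro ⟨d, hd, hdx, hdy⟩
  have hd0 := not_isDown_of_time ((time_eq_of_vertex hdx).trans hx)
  exact (h.isDown_mate_of_not hd0 hd).time_ne ((time_eq_of_vertex hdy).trans hy)

theorem time_lt_next (h : D.Timed) (hx : ¬ x.IsDown) (htip : ¬ D.IsTip x) :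
    x.time < (D.next x).time := by
  have := h.time_mate_lt _ (h.isDown_mate_of_not hx htip) (by rwa [isTip_mate])
  rwa [D.mate_mate, ← time_rot (D.mate x)] at this

theorem not_isDown_next (h : D.Timed) (hx : ¬ x.IsDown) (htip : ¬ D.IsTip x) :
    ¬ (D.next x).IsDown := by
  have hm := h.isDown_mate_of_not hx htip
  exact fun hn => (isDown_rot hm.time_ne).1 hn hm

end Timed

/-- The boundary walk from `x` to `y` only goes along edges from older vertices to newer ones. -/
def Climbs (D : Drawing t k) : HalfEdge t k → HalfEdge t k → Prop :=
  Relation.ReflTransGen fun x y => ¬ x.IsDown ∧ ¬ D.IsTip x ∧ D.next x = y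

namespace Climbs

variable {x y z : HalfEdge t k}

theorem sameBoundary (h : D.Climbs x y) : D.SameBoundary x y := by
  induction h with
  | refl => exact .refl ..
  | tail _ h ih => exact ih.trans (h.2.2 ▸ .next ..)

theorem eq_or_time_lt (hD : D.Timed) (h : D.Climbs x y) :
    x = y ∨ x.time < y.time := by
  induction h with
  | refl => exact .inl rfl
  | @tail y z _ h ih =>
    obtain ⟨hy, htip, rfl⟩ := h
    have := hD.time_lt_next hy htip
    rcases ih with rfl | ih
    exacts [.inr this, .inr (ih.trans this)]

theorem total (h : D.Climbs x z) (h' : D.Climbs y z) : D.Climbs x y ∨ D.Climbs y x := by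
  have unique : Relator.RightUnique
      (Function.swap fun x y => ¬ x.IsDown ∧ ¬ D.IsTip x ∧ D.next x = y) :=
    fun _ _ _ hb hc => D.next_injective (hb.2.2.trans hc.2.2.symm)
  have := Relation.ReflTransGen.total_of_right_unique unique
    (Relation.reflTransGen_swap.2 h) (Relation.reflTransGen_swap.2 h')
  exact (this.imp Relation.reflTransGen_swap.1 Relation.reflTransGen_swap.1).symm

theorem eq_of_time (hD : D.Timed) (h : D.Climbs x z) (h' : D.Climbs y z)
    (hx : x.time = 0) (hy : y.time = 0) : x = y := by
  rcases h.total h' with h | h <;> rcases h.eq_or_time_lt hD with h | h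
  exacts [h, by omega, h.symm, by omega]

end Climbs

theorem exists_climbs_isTip (hD : D.Timed) {x : HalfEdge t k} (hx : ¬ x.IsDown) :
    ∃ p, D.Climbs x p ∧ D.IsTip p := by
  by_cases htip : D.IsTip x
  · exact ⟨x, .refl, htip⟩
  have := hD.time_lt_next hx htip
  have := time_le (D.next x)
  obtain ⟨p, hp, hptip⟩ := exists_climbs_isTip hD (hD.not_isDown_next hx htip)
  exact ⟨p, hp.head ⟨hx, htip, rfl⟩, hptip⟩
termination_by k - x.time
decreasing_by omega

/-- An open tip at a crossbar. -/
def IsPeak (D : Drawing t k) (p : HalfEdge t k) : Prop := D.IsTip p ∧ p.time ≠ 0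

theorem exists_climbs_isPeak (hD : D.Timed) {x : HalfEdge t k} (hx : ¬ x.IsDown)
    (htip : ¬ D.IsTip x) : ∃ p, D.Climbs x p ∧ D.IsPeak p ∧ x.time < p.time := by
  obtain ⟨p, hp, hptip⟩ := exists_climbs_isTip hD hx
  rcases hp.eq_or_time_lt hD with rfl | hlt
  exacts [absurd hptip htip, ⟨p, hp, ⟨hptip, by omega⟩, hlt⟩]

end Drawing

/-! ### Minimal closed pieces -/

namespace Drawing

variable {D : Drawing t k} {X : Set (HalfEdge t k)} {u x c p q e : HalfEdge t k}

theorem IsBridge.exists_isTip (hu : D.IsBridge u) (hD : D.Timed) (ht : ∀ i, 2 ≤ t i)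
    (hu0 : u.time = 0) (h : D.SameBoundary u (D.mate u)) :
    ∃ x ∈ D.side u, D.IsTip x ∧ D.SameBoundary u x := by
  have hrot0 : u.rot.time = 0 := (time_rot u).trans hu0
  obtain ⟨p, hclimbs, htip⟩ := exists_climbs_isTip (hD.cut u) (not_isDown_of_time hrot0)
  have hp : p ∈ D.side u :=
    (D.cut u).component.trans ((D.cut u).component_rot u) hclimbs.sameBoundary.component
  have hpu : p ≠ u := by
    rintro rfl
    rcases hclimbs.eq_or_time_lt (hD.cut p) with heq | hlt
    exacts [rot_ne ht hu0 heq, by omega]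
  have hpm : p ≠ D.mate u := fun hpm => hu (hpm ▸ hp)
  have huu : D.SameBoundary u u.rot := next_mate D u ▸ h.trans (.next ..)
  have hptip : D.IsTip p := (isTip_cut.1 htip).resolve_right (by simp only [hpu, hpm, or_self,
    not_false_eq_true])
  exact ⟨p, hp, hptip, huu.trans (.of_cut h hclimbs.sameBoundary)⟩

theorem IsBridge.vertex_eq_of_adj (hu : D.IsBridge u) (hx : x ∈ D.side u) (hc : c ∉ D.side u)
    (h : D.Adj x.vertex c.vertex) : x.vertex = u.vertex := by
  obtain ⟨d, -, hdx, hdc⟩ := h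
  have hd : d ∈ D.side u := (mem_side_of_vertex_eq hdx).2 hx
  have hm : D.mate d ∉ D.side u := fun hm => hc ((mem_side_of_vertex_eq hdc).1 hm)
  by_contra hne
  have hdu : d ≠ u := fun hdu => hne (hdx ▸ congrArg vertex hdu)
  have hdm : d ≠ D.mate u := fun hdm => hu (hdm ▸ hd)
  exact hm ((mate_mem_side hdu hdm).2 hd)

/-- `X` is a union of connected components of a sparse plane drawing, with at least one crossbar,
such that each spot in `X` has an edge and joining two open tips in `X` on the same face would
create a loop, a parallel edge or a triangle. -/
structure Closed (D : Drawing t k) (X : Set (HalfEdge t k)) : Prop where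
  sparse : D.Sparse
  timed : D.Timed
  planar : D.Planar
  rot_mem : ∀ x ∈ X, x.rot ∈ X
  mate_mem : ∀ x ∈ X, D.mate x ∈ X
  not_isTip : ∀ x ∈ X, x.IsDown → ¬ D.IsTip x
  exists_spot_edge : ∀ x ∈ X, x.time = 0 → ∃ y, y.vertex = x.vertex ∧ ¬ D.IsTip y
  vertex_eq_or_adj : ∀ x ∈ X, ∀ y ∈ X, D.IsTip x → D.IsTip y → D.SameBoundary x y →
    x.vertex = y.vertex ∨ D.Adj x.vertex y.vertex
  exists_crossbar : ∃ x ∈ X, x.time ≠ 0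

namespace Closed

theorem mem_of_component (h : D.Closed X) (hx : x ∈ X) (hxc : D.component x c) : c ∈ X := by
  have hle : D.component ≤ Setoid.ker (· ∈ X) := component_le
    (fun d => propext ⟨h.rot_mem d, fun hd => ?_⟩)
    fun d => propext ⟨h.mate_mem d, fun hd => D.mate_mate d ▸ h.mate_mem _ hd⟩
  · exact Eq.mp (hle hxc) hx
  · obtain ⟨m, hm⟩ := exists_rot_iterate (vertex_rot d)
    rw [← hm]
    exact Set.MapsTo.iterate (fun x hx => h.rot_mem x hx) m hd

theorem mem_of_sameBoundary (h : D.Closed X) (hx : x ∈ X) (hxc : D.SameBoundary x c) : c ∈ X :=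
  h.mem_of_component hx hxc.component

theorem mem_of_vertex_eq (h : D.Closed X) (hx : x ∈ X) (hxc : x.vertex = c.vertex) : c ∈ X :=
  h.mem_of_component hx (component_of_vertex_eq hxc)

theorem not_isDown (h : D.Closed X) (hx : x ∈ X) (htip : D.IsTip x) : ¬ x.IsDown := fun hd =>
  h.not_isTip x hx hd htip

theorem vertex_eq_or_adj_cut (h : D.Closed X) (hb : D.IsBridge u)
    (huu : D.SameBoundary u (D.mate u))
    (htips : ∀ x ∈ X ∩ D.side u, D.IsTip x → D.SameBoundary u x → x.vertex = u.vertex) :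
    ∀ x ∈ X ∩ D.side u, ∀ y ∈ X ∩ D.side u, (D.cut u).IsTip x → (D.cut u).IsTip y →
      (D.cut u).SameBoundary x y → x.vertex = y.vertex ∨ (D.cut u).Adj x.vertex y.vertex := by
  have ne_mate : ∀ {z}, z ∈ D.side u → z ≠ D.mate u := fun hz hzm => hb (hzm ▸ hz)
  have isTip_or_eq : ∀ {z}, z ∈ D.side u → (D.cut u).IsTip z → D.IsTip z ∨ z = u :=
    fun hz htip => (isTip_cut.1 htip).imp_right fun hzu => hzu.resolve_right (ne_mate hz)
  intro x hx y hy hxtip hytip hxy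
  have hs := SameBoundary.of_cut huu hxy
  rcases isTip_or_eq hx.2 hxtip with hx' | rfl <;> rcases isTip_or_eq hy.2 hytip with hy' | rfl
  · refine (h.vertex_eq_or_adj x hx.1 y hy.1 hx' hy' hs).imp_right ?_
    rintro ⟨d, hd, hdx, hdy⟩
    have hm : D.mate d ∈ D.side u := (mem_side_of_vertex_eq hdy).2 hy.2
    have hdu : d ≠ u := fun hdu => hb (hdu ▸ hm)
    have hdm : d ≠ D.mate u := ne_mate ((mem_side_of_vertex_eq hdx).2 hx.2)
    exact ⟨d, not_isTip_cut.2 ⟨hd, hdu, hdm⟩, hdx, mate_cut_of_ne hdu hdm ▸ hdy⟩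
  · exact .inl (htips x hx hx' hs.symm)
  · exact .inl (htips y hy hy' hs).symm
  · exact .inl rfl

theorem cut (h : D.Closed X) (ht : ∀ i, 0 < t i) (hu : u ∈ X) (hdown : ¬ u.IsDown)
    (hu0 : u.time ≠ 0) (htip : ¬ D.IsTip u) (huu : D.SameBoundary u (D.mate u))
    (htips : ∀ x ∈ X ∩ D.side u, D.IsTip x → D.SameBoundary u x → x.vertex = u.vertex) :
    (D.cut u).Closed (X ∩ D.side u) where
  sparse := h.sparse.cut u
  timed := h.timed.cut u
  planar := h.planar.cut htip huu
  rot_mem x hx := ⟨h.rot_mem x hx.1, (mem_side_of_vertex_eq (vertex_rot x)).2 hx.2⟩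
  mate_mem x hx := by
    refine ⟨?_, (mem_side_congr ((D.cut u).component_mate x)).1 hx.2⟩
    by_cases hxtip : (D.cut u).IsTip x
    · rw [hxtip]
      exact hx.1
    · have hx' := (not_isTip_cut.1 hxtip).2
      rw [mate_cut_of_ne hx'.1 hx'.2]
      exact h.mate_mem x hx.1
  not_isTip x hx hxdown := by
    refine not_isTip_cut.2 ⟨h.not_isTip x hx.1 hxdown, ?_, ?_⟩
    · rintro rfl
      exact hdown hxdown
    · rintro rfl
      exact h.planar.isBridge ht htip huu hx.2
  exists_spot_edge x hx hx0 := by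
    obtain ⟨y, hy, hytip⟩ := h.exists_spot_edge x hx.1 hx0
    have hy0 : y.time = 0 := (time_eq_of_vertex hy).trans hx0
    refine ⟨y, hy, not_isTip_cut.2 ⟨hytip, ?_, ?_⟩⟩
    · rintro rfl
      exact hu0 hy0
    · rintro rfl
      exact (h.timed.isDown_mate_of_not hdown htip).time_ne hy0
  vertex_eq_or_adj := h.vertex_eq_or_adj_cut (h.planar.isBridge ht htip huu) huu htips
  exists_crossbar := ⟨u, ⟨hu, self_mem_side D u⟩, hu0⟩

end Closed

/-- There is a smaller closed set, possibly of a drawing with more cuts, whose half-edges are on the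
same boundary component only if they were so before. -/
def Shrinks (D : Drawing t k) (X : Set (HalfEdge t k)) : Prop :=
  ∃ (D₁ : Drawing t k) (X₁ : Set (HalfEdge t k)), D₁.Closed X₁ ∧ X₁ ⊂ X ∧
    ∀ x ∈ X₁, ∀ y ∈ X₁, D.SameBoundary x y → D₁.SameBoundary x y

namespace Closed

theorem shrinks_of_cut (h : D.Closed X) (ht : ∀ i, 0 < t i) (hu : u ∈ X) (hdown : ¬ u.IsDown)
    (hu0 : u.time ≠ 0) (htip : ¬ D.IsTip u) (huu : D.SameBoundary u (D.mate u))
    (htips : ∀ x ∈ X ∩ D.side u, D.IsTip x → D.SameBoundary u x → x.vertex = u.vertex) :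
    Shrinks D X :=
  have hb := h.planar.isBridge ht htip huu
  ⟨D.cut u, X ∩ D.side u, h.cut ht hu hdown hu0 htip huu htips,
    ⟨Set.inter_subset_left, fun hX => hb (hX (h.mate_mem u hu)).2⟩,
    fun _ hx _ hy hxy => hb.sameBoundary_cut hx.2 hy.2 hxy⟩

theorem shrinks_or_exists_isTip (h : D.Closed X) (ht : ∀ i, 2 ≤ t i) (hp : p ∈ X)
    (hptip : D.IsTip p) (hdown : e.IsDown) (hep : e.vertex = p.vertex)
    (hpe : D.SameBoundary p e) (hpm : D.SameBoundary p (D.mate e)) :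
    Shrinks D X ∨ (D.mate e).time = 0 ∧
      ∃ x ∈ X, D.IsTip x ∧ D.SameBoundary p x ∧ x.vertex = (D.mate e).vertex := by
  have ht0 : ∀ i, 0 < t i := fun i => two_pos.trans_le (ht i)
  have he : e ∈ X := h.mem_of_sameBoundary hp hpe
  have hetip := h.not_isTip e he hdown
  have hmtip : ¬ D.IsTip (D.mate e) := by rwa [isTip_mate]
  have huu : D.SameBoundary (D.mate e) (D.mate (D.mate e)) := by
    rw [D.mate_mate]
    exact hpm.symm.trans hpe
  have hb : D.IsBridge (D.mate e) := h.planar.isBridge ht0 hmtip huu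
  have hpside : p ∉ D.side (D.mate e) := by
    rw [← mem_side_of_vertex_eq hep]
    exact fun he => hb (by rwa [D.mate_mate])
  have htips : ∀ x ∈ X ∩ D.side (D.mate e), D.IsTip x → D.SameBoundary (D.mate e) x →
      x.vertex = (D.mate e).vertex := by
    rintro x ⟨hx, hxside⟩ hxtip hxs
    rcases h.vertex_eq_or_adj x hx p hp hxtip hptip (hpm.trans hxs).symm with hv | hadj
    · exact absurd ((mem_side_of_vertex_eq hv).1 hxside) hpside
    · exact hb.vertex_eq_of_adj hxside hpside hadj
  have hm : D.mate e ∈ X := h.mate_mem e he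
  by_cases hm0 : (D.mate e).time = 0
  · obtain ⟨x, hxside, hxtip, hxs⟩ := hb.exists_isTip h.timed ht hm0 huu
    have hx := h.mem_of_sameBoundary hm hxs
    exact .inr ⟨hm0, x, hx, hxtip, hpm.trans hxs, htips x ⟨hx, hxside⟩ hxtip hxs⟩
  · exact .inl (h.shrinks_of_cut ht0 hm (h.timed.not_isDown_mate hdown hetip) hm0 hmtip huu htips)

theorem shrinks_of_vertex_eq (h : D.Closed X) (ht : ∀ i, 2 ≤ t i) (hpX : p ∈ X)
    (hp : D.IsPeak p) (hq : D.IsPeak q) (hpq : D.SameBoundary p q) (hne : p ≠ q)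
    (hv : p.vertex = q.vertex) : Shrinks D X := by
  have hqX := h.mem_of_sameBoundary hpX hpq
  have hpd := h.not_isDown hpX hp.1
  have hqd := h.not_isDown hqX hq.1
  have hqp : q = p.rot.rot :=
    (eq_or_eq_rot_rot hp.2 hv (iff_of_false hpd hqd)).resolve_left hne.symm
  have hpp : q.rot.rot = p := by rw [hqp, rot_rot_rot_rot hp.2]
  have p_rot : D.SameBoundary p p.rot := hp.1.next_eq ▸ .next ..
  have q_rot : D.SameBoundary q q.rot := hq.1.next_eq ▸ .next ..
  have mate_p_rot : D.SameBoundary (D.mate p.rot) q := ⟨1, (next_mate ..).trans hqp.symm⟩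
  have mate_q_rot : D.SameBoundary (D.mate q.rot) p := ⟨1, (next_mate ..).trans hpp⟩
  have hpd' := (isDown_rot hp.2).2 hpd
  have hqd' := (isDown_rot hq.2).2 hqd
  rcases h.shrinks_or_exists_isTip ht hpX hp.1 hpd' (vertex_rot p) p_rot
    (hpq.trans mate_p_rot.symm) with hX | ⟨hx0, x, hx, hxtip, hpx, hxv⟩
  · exact hX
  rcases h.shrinks_or_exists_isTip ht hqX hq.1 hqd' (vertex_rot q) q_rot
    (hpq.symm.trans mate_q_rot.symm) with hX | ⟨hy0, y, hy, hytip, hqy, hyv⟩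
  · exact hX
  exfalso
  rcases h.vertex_eq_or_adj x hx y hy hxtip hytip (hpx.symm.trans (hpq.trans hqy)) with hxy | hxy
  · refine hne (rot_injective (h.sparse.eq_of_vertex p.rot q.rot
      (h.not_isTip _ (h.rot_mem _ hpX) hpd') (h.not_isTip _ (h.rot_mem _ hqX) hqd')
      (by rw [vertex_rot, vertex_rot, hv]) (by rw [← hxv, ← hyv, hxy])))
  · rw [hxv, hyv] at hxy
    exact h.timed.not_adj_of_time hx0 hy0 hxy

-- The edge going up from `p.vertex` to `q.vertex` enters the face between `p` and `q` on one of its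
-- two sides, and the down edge `e` at `p.vertex` next to that side has the face on both sides.
theorem exists_isDown_sameBoundary (h : D.Closed X) (hpX : p ∈ X) (hp : D.IsPeak p)
    (hq : D.IsPeak q) (hpq : D.SameBoundary p q) (hxtip : ¬ D.IsTip x) (hxd : ¬ x.IsDown)
    (hxp : x.vertex = p.vertex) (hxq : (D.mate x).vertex = q.vertex) :
    ∃ e, e.IsDown ∧ e.vertex = p.vertex ∧ D.SameBoundary p e ∧ D.SameBoundary p (D.mate e) := by
  have hpd := h.not_isDown hpX hp.1
  have hqd := h.not_isDown (h.mem_of_sameBoundary hpX hpq) hq.1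
  have hx0 : x.time ≠ 0 := (time_eq_of_vertex hxp).symm ▸ hp.2
  have hpx : p = x.rot.rot := by
    refine (eq_or_eq_rot_rot hx0 hxp (iff_of_false hxd hpd)).resolve_left ?_
    rintro rfl
    exact hxtip hp.1
  have hxp' : x = p.rot.rot := by rw [hpx, rot_rot_rot_rot hx0]
  have p_rot : D.SameBoundary p p.rot := hp.1.next_eq ▸ .next ..
  have q_rot : D.SameBoundary q q.rot := hq.1.next_eq ▸ .next ..
  have mate_p_rot : D.SameBoundary (D.mate p.rot) x := ⟨1, (next_mate ..).trans hxp'.symm⟩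
  have mate_x_rot : D.SameBoundary (D.mate x.rot) p := ⟨1, (next_mate ..).trans hpx.symm⟩
  have hm := h.timed.isDown_mate_of_not hxd hxtip
  rcases eq_rot_or_eq_rot hm.time_ne hxq (iff_of_true hm hqd) with hqm | hmq
  · have x_q : D.SameBoundary x q := ⟨1, hqm.symm⟩
    exact ⟨p.rot, (isDown_rot hp.2).2 hpd, vertex_rot p, p_rot,
      hpq.trans (mate_p_rot.trans x_q).symm⟩
  · have q_x_rot : D.SameBoundary q x.rot :=
      q_rot.trans (hmq ▸ ⟨1, next_mate D x⟩)
    exact ⟨x.rot, (isDown_rot hx0).2 hxd, (vertex_rot x).trans hxp, hpq.trans q_x_rot,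
      mate_x_rot.symm⟩

theorem shrinks_of_adj (h : D.Closed X) (ht : ∀ i, 2 ≤ t i) (hpX : p ∈ X) (hp : D.IsPeak p)
    (hq : D.IsPeak q) (hpq : D.SameBoundary p q) (hxtip : ¬ D.IsTip x) (hxd : ¬ x.IsDown)
    (hxp : x.vertex = p.vertex) (hxq : (D.mate x).vertex = q.vertex) : Shrinks D X := by
  obtain ⟨e, hed, hep, hpe, hpm⟩ := h.exists_isDown_sameBoundary hpX hp hq hpq hxtip hxd hxp hxq
  refine (h.shrinks_or_exists_isTip ht hpX hp.1 hed hep hpe hpm).resolve_right ?_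
  rintro ⟨hm0, y, hy, hytip, hpy, hyv⟩
  have hqX := h.mem_of_sameBoundary hpX hpq
  have hetip := h.not_isTip e (h.mem_of_sameBoundary hpX hpe) hed
  rcases h.vertex_eq_or_adj q hqX y hy hq.1 hytip (hpq.symm.trans hpy) with hqy | hqy
  · exact hq.2 (by rw [time_eq_of_vertex hqy, time_eq_of_vertex hyv, hm0])
  · exact h.sparse.no_triangle p.vertex q.vertex y.vertex ⟨x, hxtip, hxp, hxq⟩ hqy
      (Adj.symm ⟨e, hetip, hep, hyv.symm⟩)

theorem shrinks_of_isPeak (h : D.Closed X) (ht : ∀ i, 2 ≤ t i) (hpX : p ∈ X) (hp : D.IsPeak p)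
    (hq : D.IsPeak q) (hpq : D.SameBoundary p q) (hne : p ≠ q) : Shrinks D X := by
  have hqX := h.mem_of_sameBoundary hpX hpq
  rcases h.vertex_eq_or_adj p hpX q hqX hp.1 hq.1 hpq with hv | ⟨x, hxtip, hxp, hxq⟩
  · exact h.shrinks_of_vertex_eq ht hpX hp hq hpq hne hv
  by_cases hxd : x.IsDown
  · exact h.shrinks_of_adj ht hqX hq hp hpq.symm (x := D.mate x) (by rwa [isTip_mate])
      (h.timed.not_isDown_mate hxd hxtip) hxq (by rwa [D.mate_mate])
  · exact h.shrinks_of_adj ht hpX hp hq hpq hxtip hxd hxp hxq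

end Closed

end Drawing

/-! ### Edges at spots, and six faces -/

namespace HalfEdge

variable {x e : HalfEdge t k}

theorem exists_isDown (h : x.time ≠ 0) :
    ∃ e : HalfEdge t k, e.IsDown ∧ e.vertex = x.vertex := by
  by_cases hx : x.IsDown
  exacts [⟨x, hx, rfl⟩, ⟨x.rot, (isDown_rot h).2 hx, vertex_rot x⟩]

theorem vertex_rot_rot (e : HalfEdge t k) : e.rot.rot.vertex = e.vertex :=
  (vertex_rot _).trans (vertex_rot e)

theorem isDown_rot_rot (h : e.time ≠ 0) : e.rot.rot.IsDown ↔ e.IsDown := by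
  rw [isDown_rot ((time_rot e).symm ▸ h), isDown_rot h, not_not]

end HalfEdge

namespace Drawing

variable {D : Drawing t k} {X : Set (HalfEdge t k)} {x y z w p e : HalfEdge t k}
  {v v' : Vertex n k} {m : ℕ}

/-- The half-edges at `v` that belong to edges of the graph. -/
def edgesAt (D : Drawing t k) (v : Vertex n k) : Set (HalfEdge t k) :=
  {x | x.vertex = v ∧ ¬ D.IsTip x}

theorem disjoint_edgesAt (h : v ≠ v') : Disjoint (D.edgesAt v) (D.edgesAt v') :=
  Set.disjoint_left.2 fun _ hx hx' => h (hx.1.symm.trans hx'.1)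

theorem exists_isTip_of_ncard_edgesAt_lt (ht : ∀ i, m ≤ t i) (hx : x.time = 0)
    (hm : (D.edgesAt x.vertex).ncard < m) : ∃ w, w.vertex = x.vertex ∧ D.IsTip w := by
  contrapose! hm
  rcases x with ⟨i, j⟩ | x
  · have hinj : Function.Injective fun j : Fin (t i) => (.inl ⟨i, j⟩ : HalfEdge t k) :=
      Sum.inl_injective.comp sigma_mk_injective
    calc m ≤ t i := ht i
      _ = (Set.range fun j : Fin (t i) => (.inl ⟨i, j⟩ : HalfEdge t k)).ncard := by
        rw [Set.ncard_range_of_injective hinj, Nat.card_fin]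
      _ ≤ (D.edgesAt (vertex (.inl ⟨i, j⟩))).ncard :=
        Set.ncard_le_ncard (Set.range_subset_iff.2 fun _ => ⟨rfl, hm _ rfl⟩)
  · exact absurd hx (Nat.succ_ne_zero _)

theorem exists_edge_sameBoundary (hv : y.vertex = x.vertex) (hy : ¬ D.IsTip y) :
    ∃ z, z.vertex = x.vertex ∧ ¬ D.IsTip z ∧ D.SameBoundary x z := by
  obtain ⟨m, hm⟩ := exists_rot_iterate hv.symm
  induction m generalizing x with
  | zero => exact ⟨x, rfl, fun hx => hy (hm ▸ hx), .refl ..⟩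
  | succ m ih =>
    by_cases hx : D.IsTip x
    · obtain ⟨z, hz, hztip, hxz⟩ := ih (hv.trans (vertex_rot x).symm) hm
      have x_rot : D.SameBoundary x x.rot := hx.next_eq ▸ .next ..
      exact ⟨z, hz.trans (vertex_rot x), hztip, x_rot.trans hxz⟩
    · exact ⟨x, rfl, hx, .refl ..⟩

theorem exists_edge_vertex_eq_mate (hy : ¬ D.IsTip y) :
    ∃ z, z.vertex = (D.mate y).vertex ∧ ¬ D.IsTip z ∧ D.SameBoundary y z := by
  obtain ⟨z, hz, hztip, hyz⟩ := exists_edge_sameBoundary (x := D.next y) (y := D.mate y)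
    (vertex_rot _).symm (by rwa [isTip_mate])
  exact ⟨z, hz.trans (vertex_rot _), hztip, (SameBoundary.next D y).trans hyz⟩

/-- Distinct crossbar tips in `X` are on distinct boundary components. -/
def PeaksSeparated (D : Drawing t k) (X : Set (HalfEdge t k)) : Prop :=
  ∀ p ∈ X, ∀ q ∈ X, D.IsPeak p → D.IsPeak q → D.SameBoundary p q → p = q

/-- `e` is one half of the curve, drawn between two spots, on which the crossbar at `e.vertex`
was drawn. -/
structure JoinsSpots (D : Drawing t k) (e : HalfEdge t k) : Prop where
  isDown : e.IsDown
  time_mate : (D.mate e).time = 0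
  time_mate_rot_rot : (D.mate e.rot.rot).time = 0

theorem JoinsSpots.rot_rot (h : D.JoinsSpots e) : D.JoinsSpots e.rot.rot where
  isDown := (isDown_rot_rot h.isDown.time_ne).2 h.isDown
  time_mate := h.time_mate_rot_rot
  time_mate_rot_rot := by rw [rot_rot_rot_rot h.isDown.time_ne]; exact h.time_mate

namespace Closed

theorem exists_isDown_time_mate_eq_zero (h : D.Closed X) {x : HalfEdge t k} (hx : x ∈ X)
    (hd : x.IsDown) :
    ∃ y ∈ X, y.IsDown ∧ (D.mate y).time = 0 ∧ D.SameBoundary x y ∧ (y = x ∨ y.time < x.time) := by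
  by_cases hx0 : (D.mate x).time = 0
  · exact ⟨x, hx, hd, hx0, .refl .., .inl rfl⟩
  have htip := h.not_isTip x hx hd
  have hlt := h.timed.time_mate_lt x hd htip
  have hnext := (isDown_rot hx0).2 (h.timed.not_isDown_mate hd htip)
  obtain ⟨y, hy, hyd, hy0, hxy, hyx⟩ :=
    h.exists_isDown_time_mate_eq_zero (h.rot_mem _ (h.mate_mem x hx)) hnext
  have hle : y.time ≤ (D.mate x).time :=
    (hyx.elim (fun heq => (congrArg time heq).le) le_of_lt).trans_eq (time_rot _)
  exact ⟨y, hy, hyd, hy0, (SameBoundary.next D x).trans hxy, .inr (hle.trans_lt hlt)⟩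
termination_by x.time
decreasing_by rwa [time_rot]

theorem exists_isPeak_of_isTip (h : D.Closed X) (hw : w ∈ X) (hw0 : w.time = 0)
    (hwtip : D.IsTip w) : ∃ x p, x.vertex = w.vertex ∧ ¬ D.IsTip x ∧ p ∈ X ∧ D.IsPeak p ∧
      p.vertex = (D.mate x).vertex ∧ D.SameBoundary w p := by
  obtain ⟨y, hy, hytip⟩ := h.exists_spot_edge w hw hw0
  obtain ⟨z, hz, hztip, hwz⟩ := exists_edge_sameBoundary hy hytip
  obtain ⟨p, hzp, hp, -⟩ := exists_climbs_isPeak h.timed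
    (not_isDown_of_time ((time_eq_of_vertex hz).trans hw0)) hztip
  have hwp := hwz.trans hzp.sameBoundary
  have hpX := h.mem_of_sameBoundary hw hwp
  rcases h.vertex_eq_or_adj w hw p hpX hwtip hp.1 hwp with hv | ⟨x, hxtip, hxw, hxp⟩
  · exact absurd ((time_eq_of_vertex hv).symm.trans hw0) hp.2
  · exact ⟨x, p, hxw, hxtip, hpX, hp, hxp.symm, hwp⟩

theorem eq_of_sameBoundary (h : D.Closed X) (hX : D.PeaksSeparated X) (hx : x ∈ X)
    (hx0 : x.time = 0) (hy0 : y.time = 0) (hxtip : ¬ D.IsTip x) (hytip : ¬ D.IsTip y)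
    (hxy : D.SameBoundary x y) : x = y := by
  obtain ⟨p, hxp, hp, -⟩ := exists_climbs_isPeak h.timed (not_isDown_of_time hx0) hxtip
  obtain ⟨q, hyq, hq, -⟩ := exists_climbs_isPeak h.timed (not_isDown_of_time hy0) hytip
  have hpX := h.mem_of_sameBoundary hx hxp.sameBoundary
  have hpq := hxp.sameBoundary.symm.trans (hxy.trans hyq.sameBoundary)
  obtain rfl := hX p hpX q (h.mem_of_sameBoundary hpX hpq) hp hq hpq
  exact hxp.eq_of_time h.timed hyq hx0 hy0

theorem not_sameBoundary_rot_rot (h : D.Closed X) (hX : D.PeaksSeparated X) (hpX : p ∈ X)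
    (hp : D.IsPeak p) : ¬ D.SameBoundary p p.rot.rot := by
  intro hs
  have hnot : ¬ p.rot.rot.IsDown := mt (isDown_rot_rot hp.2).1 (h.not_isDown hpX hp.1)
  obtain ⟨q, hclimbs, hqtip⟩ := exists_climbs_isTip h.timed hnot
  have hpq := hs.trans hclimbs.sameBoundary
  have hq0 : q.time ≠ 0 := by
    rcases hclimbs.eq_or_time_lt h.timed with rfl | hlt
    exacts [by simpa only [time_rot] using hp.2, by omega]
  obtain rfl := hX p hpX q (h.mem_of_sameBoundary hpX hpq) hp ⟨hqtip, hq0⟩ hpq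
  rcases hclimbs.eq_or_time_lt h.timed with heq | hlt
  exacts [rot_rot_ne hp.2 heq, by simp only [time_rot, lt_irrefl] at hlt]

-- The boundary walk down the curve from `p.rot` arrives at a spot, and there meets the only edge of
-- the face at a spot, namely `z`.
theorem exists_isDown_vertex_mate_eq (h : D.Closed X) (hX : D.PeaksSeparated X) (hpX : p ∈ X)
    (hp : D.IsPeak p) (hz0 : z.time = 0) (hztip : ¬ D.IsTip z) (hpz : D.SameBoundary p z) :
    ∃ y ∈ X, y.IsDown ∧ (D.mate y).vertex = z.vertex ∧ (y = p.rot ∨ y.time < p.time) := by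
  have hprot : p.rot.IsDown := (isDown_rot hp.2).2 (h.not_isDown hpX hp.1)
  have p_rot : D.SameBoundary p p.rot := hp.1.next_eq ▸ .next ..
  obtain ⟨y, hy, hyd, hy0, hpy, hyp⟩ :=
    h.exists_isDown_time_mate_eq_zero (h.rot_mem p hpX) hprot
  obtain ⟨z', hz', hztip', hyz⟩ := exists_edge_vertex_eq_mate (h.not_isTip y hy hyd)
  obtain rfl := h.eq_of_sameBoundary hX (h.mem_of_sameBoundary hpX hpz) hz0
    ((time_eq_of_vertex hz').trans hy0) hztip hztip' (hpz.symm.trans (p_rot.trans (hpy.trans hyz)))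
  exact ⟨y, hy, hyd, hz'.symm, hyp.imp_right fun hlt => hlt.trans_eq (time_rot p)⟩

theorem two_le_ncard_edgesAt (h : D.Closed X) (ht : ∀ i, 2 ≤ t i) (hX : D.PeaksSeparated X)
    (hx : x ∈ X) (hx0 : x.time = 0) : 2 ≤ (D.edgesAt x.vertex).ncard := by
  by_contra! hcard
  have unique := Set.ncard_le_one_iff_subsingleton.1 (Nat.le_of_lt_succ hcard)
  obtain ⟨w, hw, hwtip⟩ := exists_isTip_of_ncard_edgesAt_lt ht hx0 hcard
  have hw0 := (time_eq_of_vertex hw).trans hx0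
  obtain ⟨z, p, hzw, hztip, hpX, hp, hpz, hwp⟩ :=
    h.exists_isPeak_of_isTip (h.mem_of_vertex_eq hx hw.symm) hw0 hwtip
  have hz0 := (time_eq_of_vertex hzw).trans hw0
  have hz : z ∈ D.edgesAt x.vertex := ⟨hzw.trans hw, hztip⟩
  have hzp : D.SameBoundary z p := by
    obtain ⟨z', hz', hztip', hwz⟩ := exists_edge_sameBoundary hzw hztip
    obtain rfl := unique hz ⟨hz'.trans hw, hztip'⟩
    exact hwz.symm.trans hwp
  have hzd := not_isDown_of_time hz0
  have hmate := h.timed.isDown_mate_of_not hzd hztip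
  have hpd := h.not_isDown hpX hp.1
  rcases eq_rot_or_eq_rot hp.2 hpz (iff_of_false hpd (not_not.2 hmate)) with hm | hm
  · refine h.not_sameBoundary_rot_rot hX hpX hp (hzp.symm.trans ?_)
    exact hm ▸ SameBoundary.next D z
  · obtain ⟨y, hy, hyd, hyz, hyp⟩ := h.exists_isDown_vertex_mate_eq hX hpX hp hz0 hztip hzp.symm
    have hmy : D.mate y = z := unique ⟨hyz.trans hz.1, by
      rw [isTip_mate]
      exact h.not_isTip y hy hyd⟩ hz
    have hyq : y = D.mate z := by rw [← hmy, D.mate_mate]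
    rcases hyp with hyp | hyp
    · exact rot_rot_ne hp.2 (by rw [← hyp, hyq, hm])
    · rw [hyq, time_eq_of_vertex hpz] at hyp
      exact lt_irrefl _ hyp

theorem vertex_mate_ne (h : D.Closed X) (he : e ∈ X) (hd : e.IsDown) :
    (D.mate e).vertex ≠ (D.mate e.rot.rot).vertex := fun heq =>
  have he' := h.not_isTip _ (h.rot_mem _ (h.rot_mem e he)) ((isDown_rot_rot hd.time_ne).2 hd)
  rot_rot_ne hd.time_ne
    (h.sparse.eq_of_vertex e e.rot.rot (h.not_isTip e he hd) he' (vertex_rot_rot e).symm heq).symm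

-- The boundary walk through an open tip of a crossbar that joins two spots passes both spots.
theorem not_isPeak_of_joinsSpots (h : D.Closed X) (hX : D.PeaksSeparated X) (hpX : p ∈ X)
    (he : D.JoinsSpots e) (hep : e.vertex = p.vertex) : ¬ D.IsPeak p := by
  intro hp
  have hprot : p.rot.IsDown := (isDown_rot hp.2).2 (h.not_isDown hpX hp.1)
  have hpe : D.JoinsSpots p.rot := by
    rcases eq_or_eq_rot_rot he.isDown.time_ne (hep.trans (vertex_rot p).symm)
      (iff_of_true he.isDown hprot) with heq | heq <;> rw [heq]
    exacts [he, he.rot_rot]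
  have hprotX := h.rot_mem p hpX
  have hback : p.rot.rot.rot ∈ X := h.rot_mem _ (h.rot_mem _ hprotX)
  have p_rot : D.SameBoundary p p.rot := hp.1.next_eq ▸ .next ..
  have mate_p : D.SameBoundary (D.mate p.rot.rot.rot) p :=
    ⟨1, (next_mate ..).trans (rot_rot_rot_rot hp.2)⟩
  obtain ⟨z, hz, hztip, hpz⟩ := exists_edge_vertex_eq_mate (h.not_isTip _ hprotX hprot)
  have hmz : D.mate p.rot.rot.rot = z :=
    h.eq_of_sameBoundary hX (h.mate_mem _ hback) hpe.time_mate_rot_rot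
      ((time_eq_of_vertex hz).trans hpe.time_mate)
      (by rw [isTip_mate]; exact h.not_isTip _ hback hpe.rot_rot.isDown) hztip
      (mate_p.trans (p_rot.trans hpz))
  exact h.vertex_mate_ne hprotX hprot (by rw [hmz, hz])

theorem exists_isDown_vertex_notMem (h : D.Closed X) {V : Set (Vertex n k)}
    (hV : ∃ x ∈ X, x.time ≠ 0 ∧ x.vertex ∉ V) :
    ∃ e ∈ X, e.IsDown ∧ e.vertex ∉ V ∧ ∀ f, f.IsDown → f.vertex = e.vertex →
      (D.mate f).time = 0 ∨ (D.mate f).vertex ∈ V := by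
  obtain ⟨x, ⟨hx, hx0, hxV⟩, hmin⟩ :=
    Set.exists_min_image {x | x ∈ X ∧ x.time ≠ 0 ∧ x.vertex ∉ V} time (Set.toFinite _) hV
  obtain ⟨e, hed, hex⟩ := exists_isDown hx0
  refine ⟨e, h.mem_of_vertex_eq hx hex.symm, hed, hex ▸ hxV, fun f hfd hfe => ?_⟩
  by_contra! hf
  have hfx := hfe.trans hex
  have hfX := h.mem_of_vertex_eq hx hfx.symm
  have hlt := h.timed.time_mate_lt f hfd (h.not_isTip f hfX hfd)
  exact (hmin _ ⟨h.mate_mem f hfX, hf⟩).not_gt (hlt.trans_eq (time_eq_of_vertex hfx))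

theorem exists_joinsSpots (h : D.Closed X) : ∃ e ∈ X, D.JoinsSpots e := by
  obtain ⟨x, hx, hx0⟩ := h.exists_crossbar
  obtain ⟨e, he, hed, -, hmate⟩ :=
    h.exists_isDown_vertex_notMem (V := ∅) ⟨x, hx, hx0, Set.notMem_empty _⟩
  simp only [Set.mem_empty_iff_false, or_false] at hmate
  exact ⟨e, he, hed, hmate e hed rfl,
    hmate _ ((isDown_rot_rot hed.time_ne).2 hed) (vertex_rot_rot e)⟩

theorem exists_joinsSpots_vertex_ne (h : D.Closed X) (he : e ∈ X) (hed : e.IsDown)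
    (hspots : ∀ s ∈ X, s.time = 0 →
      s.vertex = (D.mate e).vertex ∨ s.vertex = (D.mate e.rot.rot).vertex)
    (hne : ∃ x ∈ X, x.time ≠ 0 ∧ x.vertex ≠ e.vertex) :
    ∃ f ∈ X, D.JoinsSpots f ∧ f.vertex ≠ e.vertex := by
  obtain ⟨f, hf, hfd, hfe, hmate⟩ := h.exists_isDown_vertex_notMem (V := {e.vertex}) hne
  have adj_spot : ∀ s ∈ X, s.time = 0 → D.Adj e.vertex s.vertex := fun s hs hs0 => by
    rcases hspots s hs hs0 with hse | hse
    · exact ⟨e, h.not_isTip e he hed, rfl, hse.symm⟩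
    · exact ⟨e.rot.rot, h.not_isTip _ (h.rot_mem _ (h.rot_mem e he))
        ((isDown_rot_rot hed.time_ne).2 hed), vertex_rot_rot e, hse.symm⟩
  have time_mate : ∀ g, g.IsDown → g.vertex = f.vertex → (D.mate g).time = 0 := by
    intro g hgd hgf
    refine (hmate g hgd hgf).resolve_right fun hge => ?_
    have hg := h.mem_of_vertex_eq hf hgf.symm
    have hg' := h.rot_mem _ (h.rot_mem g hg)
    have hgd' := (isDown_rot_rot hgd.time_ne).2 hgd
    have hg0 : (D.mate g.rot.rot).time = 0 :=
      (hmate _ hgd' ((vertex_rot_rot g).trans hgf)).resolve_right fun hge' =>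
        h.vertex_mate_ne hg hgd (hge.trans hge'.symm)
    exact h.sparse.no_triangle g.vertex e.vertex (D.mate g.rot.rot).vertex
      ⟨g, h.not_isTip g hg hgd, rfl, hge⟩ (adj_spot _ (h.mate_mem _ hg') hg0)
      (Adj.symm ⟨g.rot.rot, h.not_isTip _ hg' hgd', vertex_rot_rot g, rfl⟩)
  exact ⟨f, hf, ⟨hfd, time_mate f hfd rfl, time_mate _ ((isDown_rot_rot hfd.time_ne).2 hfd)
    (vertex_rot_rot f)⟩, hfe⟩

theorem exists_joinsSpots_mate_vertex_eq (h : D.Closed X) (he : e ∈ X) (hed : e.IsDown)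
    (hspots : ∀ s ∈ X, s.time = 0 →
      s.vertex = (D.mate e).vertex ∨ s.vertex = (D.mate e.rot.rot).vertex)
    (hne : ∃ x ∈ X, x.time ≠ 0 ∧ x.vertex ≠ e.vertex) :
    ∃ f ∈ X, D.JoinsSpots f ∧ f.vertex ≠ e.vertex ∧ (D.mate f).vertex = (D.mate e).vertex := by
  obtain ⟨f, hf, hjoins, hfe⟩ := h.exists_joinsSpots_vertex_ne he hed hspots hne
  have hf' := h.rot_mem _ (h.rot_mem f hf)
  rcases hspots _ (h.mate_mem f hf) hjoins.time_mate with hm | hm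
  · exact ⟨f, hf, hjoins, hfe, hm⟩
  · refine ⟨_, hf', hjoins.rot_rot, (vertex_rot_rot f).trans_ne hfe, ?_⟩
    exact (hspots _ (h.mate_mem _ hf') hjoins.time_mate_rot_rot).resolve_right fun hm' =>
      h.vertex_mate_ne hf hjoins.isDown (hm.trans hm'.symm)

end Closed

end Drawing

namespace Drawing

variable {D : Drawing t k} {X : Set (HalfEdge t k)} {x e : HalfEdge t k}

namespace Closed

theorem three_le_ncard_edgesAt (h : D.Closed X) (ht : ∀ i, 3 ≤ t i) (hX : D.PeaksSeparated X)
    (heX : e ∈ X) (he : D.JoinsSpots e) (hspots : ∀ s ∈ X, s.time = 0 →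
      s.vertex = (D.mate e).vertex ∨ s.vertex = (D.mate e.rot.rot).vertex) :
    3 ≤ (D.edgesAt (D.mate e).vertex).ncard := by
  by_contra! hcard
  obtain ⟨w, hw, hwtip⟩ := exists_isTip_of_ncard_edgesAt_lt ht he.time_mate hcard
  obtain ⟨x, p, hxw, hxtip, hpX, hp, hpx, -⟩ := h.exists_isPeak_of_isTip
    (h.mem_of_vertex_eq (h.mate_mem e heX) hw.symm) ((time_eq_of_vertex hw).trans he.time_mate)
    hwtip
  have hx : x ∈ D.edgesAt (D.mate e).vertex := ⟨hxw.trans hw, hxtip⟩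
  -- As `p` is a tip at `(D.mate x).vertex`, the crossbar there does not join two spots.
  have ne_mate : ∀ f, D.JoinsSpots f → x ≠ D.mate f := by
    rintro f hf rfl
    exact h.not_isPeak_of_joinsSpots hX hpX hf (by rw [hpx, D.mate_mate]) hp
  have mate_mem : ∀ f ∈ X, f.IsDown → (D.mate f).vertex = (D.mate e).vertex →
      D.mate f ∈ D.edgesAt (D.mate e).vertex := fun f hf hfd hfe =>
    ⟨hfe, by rw [isTip_mate]; exact h.not_isTip f hf hfd⟩
  have hme := mate_mem e heX he.isDown rfl
  have hpe : p.vertex ≠ e.vertex := fun hpe => ne_mate e he <|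
    h.sparse.eq_of_vertex _ _ hxtip hme.2 hx.1 (by rw [D.mate_mate, ← hpx, hpe])
  obtain ⟨f, hfX, hf, hfe, hfm⟩ :=
    h.exists_joinsSpots_mate_vertex_eq heX he.isDown hspots ⟨p, hpX, hp.2, hpe⟩
  have hmf := mate_mem f hfX hf.isDown hfm
  have hef : D.mate e ≠ D.mate f := fun hef => hfe (by rw [← D.mate_mate f, ← hef, D.mate_mate])
  refine hcard.not_ge ?_
  calc 3 = ({x, D.mate e, D.mate f} : Set (HalfEdge t k)).ncard :=
        (Set.ncard_eq_three.2 ⟨_, _, _, ne_mate e he, ne_mate f hf, hef, rfl⟩).symm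
    _ ≤ (D.edgesAt (D.mate e).vertex).ncard :=
        Set.ncard_le_ncard (by simp only [Set.insert_subset_iff, Set.singleton_subset_iff, hx, hme,
          hmf, and_self])

theorem edgesAt_subset (h : D.Closed X) (hx : x ∈ X) (hx0 : x.time = 0) :
    D.edgesAt x.vertex ⊆ {y ∈ X | y.time = 0 ∧ ¬ D.IsTip y} := fun _ hy =>
  ⟨h.mem_of_vertex_eq hx hy.1.symm, (time_eq_of_vertex hy.1).trans hx0, hy.2⟩

theorem six_le_ncard (h : D.Closed X) (ht : ∀ i, 3 ≤ t i) (hX : D.PeaksSeparated X) :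
    6 ≤ {x ∈ X | x.time = 0 ∧ ¬ D.IsTip x}.ncard := by
  obtain ⟨e, he, hjoins⟩ := h.exists_joinsSpots
  have he' := h.rot_mem _ (h.rot_mem e he)
  have hne := h.vertex_mate_ne he hjoins.isDown
  have hsub := Set.union_subset (h.edgesAt_subset (h.mate_mem e he) hjoins.time_mate)
    (h.edgesAt_subset (h.mate_mem _ he') hjoins.time_mate_rot_rot)
  have ht' : ∀ i, 2 ≤ t i := fun i => (Nat.le_succ 2).trans (ht i)
  by_cases hspots : ∀ s ∈ X, s.time = 0 →
      s.vertex = (D.mate e).vertex ∨ s.vertex = (D.mate e.rot.rot).vertex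
  · have hspots' : ∀ s ∈ X, s.time = 0 → s.vertex = (D.mate e.rot.rot).vertex ∨
        s.vertex = (D.mate e.rot.rot.rot.rot).vertex := fun s hs hs0 => by
      rw [rot_rot_rot_rot hjoins.isDown.time_ne]
      exact (hspots s hs hs0).symm
    have := h.three_le_ncard_edgesAt ht hX he hjoins hspots
    have := h.three_le_ncard_edgesAt ht hX he' hjoins.rot_rot hspots'
    have := Set.ncard_le_ncard hsub
    rw [Set.ncard_union_eq (disjoint_edgesAt hne)] at this
    omega
  · push Not at hspots
    obtain ⟨s, hs, hs0, hse, hse'⟩ := hspots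
    have := h.two_le_ncard_edgesAt ht' hX (h.mate_mem e he) hjoins.time_mate
    have := h.two_le_ncard_edgesAt ht' hX (h.mate_mem _ he') hjoins.time_mate_rot_rot
    have := h.two_le_ncard_edgesAt ht' hX hs hs0
    have := Set.ncard_le_ncard (Set.union_subset hsub (h.edgesAt_subset hs hs0))
    rw [Set.ncard_union_eq (Set.disjoint_union_left.2 ⟨disjoint_edgesAt hse.symm,
      disjoint_edgesAt hse'.symm⟩), Set.ncard_union_eq (disjoint_edgesAt hne)] at this
    omega

theorem exists_pairwise_not_sameBoundary (ht : ∀ i, 3 ≤ t i) {D : Drawing t k}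
    {X : Set (HalfEdge t k)} (h : D.Closed X) :
    ∃ A ⊆ X, 6 ≤ A.ncard ∧ A.Pairwise fun x y => ¬ D.SameBoundary x y := by
  by_cases hX : Shrinks D X
  · obtain ⟨D₁, X₁, h₁, hlt, hs⟩ := hX
    have := Set.ncard_lt_ncard hlt
    obtain ⟨A, hAX, hcard, hA⟩ := exists_pairwise_not_sameBoundary ht h₁
    exact ⟨A, hAX.trans hlt.subset, hcard, fun x hx y hy hne hxy =>
      hA hx hy hne (hs x (hAX hx) y (hAX hy) hxy)⟩
  · have ht' : ∀ i, 2 ≤ t i := fun i => (Nat.le_succ 2).trans (ht i)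
    have hsep : D.PeaksSeparated X := fun p hpX q _ hp hq hpq =>
      by_contra fun hne => hX (h.shrinks_of_isPeak ht' hpX hp hq hpq hne)
    exact ⟨_, Set.sep_subset .., h.six_le_ncard ht hsep, fun x hx y hy hne hxy =>
      hne (h.eq_of_sameBoundary hsep hx.1 hx.2.1 hy.2.1 hx.2.2 hy.2.2 hxy)⟩
termination_by X.ncard

end Closed

theorem six_le_numBoundaries (h : D.Closed Set.univ) (ht : ∀ i, 3 ≤ t i) :
    6 ≤ D.numBoundaries := by
  obtain ⟨A, -, hcard, hA⟩ := Closed.exists_pairwise_not_sameBoundary ht h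
  calc 6 ≤ A.ncard := hcard
    _ = ((Quotient.mk D.boundary) '' A).ncard := (Set.InjOn.ncard_image fun x hx y hy hxy =>
        by_contra fun hne => hA hx hy hne (Quotient.exact hxy)).symm
    _ ≤ D.numBoundaries := Set.ncard_le_card _

end Drawing

theorem Drawing.sparse_start : (Drawing.start t).Sparse where
  not_adj_self := fun _ ⟨_, hd, _⟩ => hd rfl
  eq_of_vertex _ _ hd := absurd rfl hd
  no_triangle := fun _ _ _ ⟨_, hd, _⟩ => absurd rfl hd

namespace Drawing

variable {D : Drawing t k} {x y : HalfEdge t k}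

theorem vertex_eq_or_adj_of_ended (hD : D.Sparse) (hend : Ended GirthAtLeastFour D)
    (hx : D.IsTip x) (hy : D.IsTip y) (hxy : D.region x y) :
    x.vertex = y.vertex ∨ D.Adj x.vertex y.vertex := by
  by_contra! hne
  obtain ⟨D', h⟩ := exists_isMove hx hy (ne_of_apply_ne vertex hne.1) hxy
  exact hend x y D' h (sparse_iff.2 (h.sparse hD hne.1 hne.2))

theorem exists_edge_of_component_eq_top (hn : 2 ≤ n) (ht : ∀ i, 0 < t i)
    (hD : D.component = ⊤) (x : HalfEdge t k) : ∃ y, y.vertex = x.vertex ∧ ¬ D.IsTip y := by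
  by_contra! htips
  have hle : D.component ≤ Setoid.ker fun y => y.vertex = x.vertex :=
    component_le (fun d => by rw [Setoid.ker_def, vertex_rot]) fun d => by
      by_cases hd : d.vertex = x.vertex
      · rw [htips d hd]
      · have hm : (D.mate d).vertex ≠ x.vertex := fun hm =>
          hd (by rw [← hm, isTip_mate.1 (htips _ hm)])
        simp only [Setoid.ker_def, hd, hm]
  have eq_vertex : ∀ y : HalfEdge t k, y.vertex = x.vertex := fun y =>
    (hle (hD ▸ trivial : D.component x y)).mp rfl
  have h01 := (eq_vertex (.inl ⟨⟨0, by omega⟩, 0, ht _⟩)).trans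
    (eq_vertex (.inl ⟨⟨1, by omega⟩, 0, ht _⟩)).symm
  simp [vertex] at h01

end Drawing

namespace Reachable

open Drawing

variable {F : ∀ {α β : Type}, Graph α β → Prop} {D : Drawing t k} {x y : HalfEdge t k}

theorem not_isTip_of_isDown (hD : Reachable F t k D) : ∀ d, d.IsDown → ¬ D.IsTip d := by
  induction hD with
  | start =>
    rintro (d | ⟨j, s⟩) hd
    exacts [hd.elim, j.elim0]
  | move _ h _ ih => exact h.not_isTip_of_isDown ih

theorem timed (hD : Reachable F t k D) : D.Timed := by
  induction hD with
  | start => exact ⟨fun _ hd => absurd rfl hd, fun _ _ hd => absurd rfl hd⟩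
  | move hD h _ ih => exact h.timed ih hD.not_isTip_of_isDown

theorem sparse (hD : Reachable GirthAtLeastFour t k D) : D.Sparse := by
  cases hD with
  | start => exact sparse_start
  | move _ _ hF => exact sparse_iff.1 hF

theorem sameBoundary_of_ended (hn : 0 < n) (ht : ∀ i, 0 < t i)
    (hD : Reachable GirthAtLeastFour t k D) (hend : Ended GirthAtLeastFour D)
    (hxy : D.region x y) : D.SameBoundary x y := by
  obtain ⟨p, hp, hxp⟩ := hD.exists_isTip_sameBoundary x
  obtain ⟨q, hq, hyq⟩ := hD.exists_isTip_sameBoundary y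
  have hr : D.region p q :=
    D.region.trans (D.region.symm hxp.region) (D.region.trans hxy hyq.region)
  have hcomp : D.component p q :=
    (vertex_eq_or_adj_of_ended hD.sparse hend hp hq hr).elim component_of_vertex_eq component_of_adj
  have hpq : D.SameBoundary p q :=
    not_imp_not.1 (hD.not_component hn ht hp hq hr) hcomp
  exact hxp.trans (hpq.trans hyq.symm)

theorem component_eq_top_of_ended (hn : 0 < n) (ht : ∀ i, 0 < t i)
    (hD : Reachable GirthAtLeastFour t k D) (hend : Ended GirthAtLeastFour D) :
    D.component = ⊤ := by
  have hle : D.region ≤ D.component := fun _ _ hxy =>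
    (hD.sameBoundary_of_ended hn ht hend hxy).component
  rw [← hD.region_sup_component, sup_eq_right.2 hle]

theorem closed_univ_of_ended (hn : 2 ≤ n) (ht : ∀ i, 0 < t i)
    (hD : Reachable GirthAtLeastFour t k D) (hend : Ended GirthAtLeastFour D) :
    D.Closed Set.univ := by
  have exists_edge := exists_edge_of_component_eq_top hn ht
    (hD.component_eq_top_of_ended (by omega) ht hend)
  exact {
    sparse := hD.sparse
    timed := hD.timed
    planar := hD.planar (by omega) ht
    rot_mem := fun _ _ => trivial
    mate_mem := fun _ _ => trivial
    not_isTip := fun x _ => hD.not_isTip_of_isDown x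
    exists_spot_edge := fun x _ _ => exists_edge x
    vertex_eq_or_adj := fun _ _ _ _ hx hy hxy =>
      vertex_eq_or_adj_of_ended hD.sparse hend hx hy hxy.region
    exists_crossbar := by
      obtain ⟨y, hy, hytip⟩ := exists_edge (.inl ⟨⟨0, by omega⟩, 0, ht _⟩)
      have hm := hD.timed.isDown_mate_of_not (not_isDown_of_time (time_eq_of_vertex hy)) hytip
      exact ⟨D.mate y, trivial, hm.time_ne⟩ }

theorem add_four_le (hn : 2 ≤ n) (ht : ∀ i, 3 ≤ t i) (hD : Reachable GirthAtLeastFour t k D)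
    (hend : Ended GirthAtLeastFour D) : n + 4 ≤ k := by
  have ht0 : ∀ i, 0 < t i := fun i => three_pos.trans_le (ht i)
  have := six_le_numBoundaries (hD.closed_univ_of_ended hn ht0 hend) ht
  have := hD.numBoundaries_add_le ht0
  have numComponents_le : D.numComponents ≤ 1 := by
    rw [numComponents, hD.component_eq_top_of_ended (by omega) ht0 hend]
    exact Finite.card_le_one_iff_subsingleton.2
      ⟨Quotient.ind₂ fun _ _ => Quotient.sound trivial⟩
  omega

end Reachable

end BrusselsSprout

theorem mainTheorem10 (n : ℕ) (hn : 2 ≤ n) (t : Fin n → ℕ) (ht : ∀ i, 3 ≤ t i) :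
    (∀ (k : ℕ) (D : BrusselsSprout.Drawing t k),
      BrusselsSprout.Reachable BrusselsSprout.GirthAtLeastFour t k D →
        k ≤ (n - 2) + ∑ i, t i) ∧
    (∀ (k : ℕ) (D : BrusselsSprout.Drawing t k),
      BrusselsSprout.Reachable BrusselsSprout.GirthAtLeastFour t k D →
        BrusselsSprout.Ended BrusselsSprout.GirthAtLeastFour D →
          n + 4 ≤ k ∧ k ≤ (n - 2) + ∑ i, t i) := by
  have hn0 : 0 < n := two_pos.trans_le hn
  have ht0 : ∀ i, 0 < t i := fun i => three_pos.trans_le (ht i)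
  have upper : ∀ (k : ℕ) (D : BrusselsSprout.Drawing t k),
      BrusselsSprout.Reachable BrusselsSprout.GirthAtLeastFour t k D →
        k ≤ (n - 2) + ∑ i, t i := fun k D hD => by
    have := hD.add_two_le hn0 ht0
    omega
  exact ⟨upper, fun k D hD hend => ⟨hD.add_four_le hn ht hend, upper k D hD⟩⟩
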